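/- Let $\gamma\in\mathbb R$ and let $L:(1,\infty)\to(0,\infty)$ be continuous and slowly varying at infinity, i.e. $L(az)/L(z)\to1$ as $z\to\infty$ for every $a>0$. Let $\beta>0$. Then there is a constant $C\in(0,\infty)$, depending only on $\gamma$, $L$ and $\beta$ (so only on $\gamma$ and $L$ if $\beta=1$ is fixed), with the following property. Let $\xi$ be a symmetrically distributed real random variable whose tail $T(x)=\mathbf P(|\xi|\ge x)$ satisfies $$T(x)=x^{-2}(\log x)^{\gamma}L(\log x),\qquad x>e,$$ and let $\xi(1),\xi(2),\dots$ be independent random variables with the law of $\xi$. Put $\psi(t)=1-\mathrm{Re}\,\mathbf E e^{it\xi}$. Let $b(1)=1$ and, for each $n\ge2$ for which the equation $\psi(1/s)=1/n$ has a solution $s>0$, let $b(n)$ be a positive solution of it, i.e. $\psi(1/b(n))=1/n$. Assume that $b(n)\ge\beta$ for every $n$ for which $b(n)$ is defined. Let $$S(n)=\frac1{b(n)}\sum_{k=1}^n\xi(k),\qquad U(x)=\sup_n\mathbf P(|S(n)|\ge x),$$ where the supremum is over all $n\ge1$ for which $b(n)$ is defined. Then: A. if $\gamma\ge-1$, then for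 all $x>e$ $$U(x)\le C\,x^{-2}(\log x)^{\gamma+1}L(\log x)=C\,T(x)\log x;$$ B. if $\gamma<-1$, then $U(x)\le C\,x^{-2}$ for all $x>1$. -/

import Mathlib

open MeasureTheory ProbabilityTheory Filter Topology Finset

noncomputable section

namespace UniformTail

/-- A positive continuous slowly varying function. Only its values on `(1, ∞)` matter, since it is
evaluated at `log x` for `x > e`. -/
structure IsSlowlyVarying (L : ℝ → ℝ) : Prop where
  pos : ∀ z, 1 < z → 0 < L z
  continuousOn : ContinuousOn L (Set.Ioi 1)
  tendsto_ratio : ∀ a, 0 < a → Tendsto (fun z => L (a * z) / L z) atTop (𝓝 1)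

variable {Ω : Type*} [MeasurableSpace Ω]

/-- The tail function `T(x) = P(|X| ≥ x)`. -/
def tail (P : Measure Ω) (X : Ω → ℝ) (x : ℝ) : ℝ :=
  P.real {ω | x ≤ |X ω|}

/-- The tail is `x ^ (-r) (log x) ^ γ L(log x)` for all `x > e`. -/
def HasRegularTail (P : Measure Ω) (X : Ω → ℝ) (r γ : ℝ) (L : ℝ → ℝ) : Prop :=
  ∀ x, Real.exp 1 < x → tail P X x = x ^ (-r) * Real.log x ^ γ * L (Real.log x)

/-- The distribution of `X` is symmetric: `X` and `-X` have the same law. -/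
def IsSymmetric (P : Measure Ω) (X : Ω → ℝ) : Prop :=
  IdentDistrib X (-X) P P

/-- `ψ(t) = 1 - Re φ(t)`, where `φ` is the characteristic function of `X`. -/
def psi (P : Measure Ω) (X : Ω → ℝ) (t : ℝ) : ℝ :=
  1 - (charFun (P.map X) t).re

/-- The set of `n ≥ 1` for which the norming constant `b(n)` is defined: `n = 1`, and those
`n ≥ 2` for which the equation `ψ(1 / s) = 1 / n` has a positive solution `s`. -/
def normable (P : Measure Ω) (X : Ω → ℝ) : Set ℕ :=
  {n | n = 1 ∨ (2 ≤ n ∧ ∃ s : ℝ, 0 < s ∧ psi P X (1 / s) = 1 / n)}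

/-- `b` is a natural norming sequence of `X`: `b(1) = 1`, and for `n ≥ 2` the number `b(n)` is a
positive solution of `ψ(1 / b(n)) = 1 / n`, whenever there is one. -/
structure IsNaturalNorming (P : Measure Ω) (X : Ω → ℝ) (b : ℕ → ℝ) : Prop where
  one : b 1 = 1
  pos : ∀ n ∈ normable P X, 0 < b n
  psi_eq : ∀ n ∈ normable P X, 2 ≤ n → psi P X (1 / b n) = 1 / n

/-- The normed sum `S(n)` of the first `n` terms `ξ 0, …, ξ (n - 1)`. -/
def normedSum (ξ : ℕ → Ω → ℝ) (b : ℕ → ℝ) (n : ℕ) (ω : Ω) : ℝ :=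
  (b n)⁻¹ * ∑ k ∈ range n, ξ k ω

/-- The uniform tail function `U(x) = sup_n P(|S(n)| ≥ x)`, the supremum being over those `n ≥ 1`
for which `b(n)` is defined (a nonempty set of numbers in `[0, 1]` for a probability measure). -/
def uniformTail (P : Measure Ω) (ξ : ℕ → Ω → ℝ) (b : ℕ → ℝ) (x : ℝ) : ℝ :=
  ⨆ n : normable P (ξ 0), tail P (normedSum ξ b n) x

end UniformTail

end

/-! A large normed sum is caused by one large summand. With `y = x * b n / 6`, truncation at `y` and
a Chernoff bound (`measureReal_abs_sum_le`) give `P(|S(n)| ≥ x) ≤ n T(y) + 2 e² r³`, where `r`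
bounds `n V(y) / y²` and `V` is the truncated second moment. The equation `ψ(1/b) = 1/n` yields `n
V(b) ≤ 5 b²`, and `V` grows at most linearly, so `r` is of order `1/x` and the error is `O(x⁻³)`.

For the main term write `T(e^u) e^(2u) = l(u)` with `l(u) = u^γ L(u)`, `s = log b`, `t = log x`. Up
to constants, `n T(y) x²` is `n l(s + t) / b²`. For large `b` there are two bounds on `n`: `n ≤ K
b²`, and `n s l(s) ≤ K b²` because `V(e^s)` is at least a multiple of `s l(s)`. If `s ≤ t`, then
`l(s + t)` is comparable to `l(t) ≤ t l(t)`. If `s > t`, it is comparable to `l(s)`, and the second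
bound leaves `1/t`, which is at most a multiple of `t l(t)` when `γ ≥ -1`. When `γ < -1`, `l` is
bounded and the first bound on `n` suffices.

The constants must not depend on the law of `ξ`. Beyond `e` the tail is prescribed, which controls
`V` at large arguments (`TailMoment.exists_growth_constants`). For `b` in a compact range, `ψ(1/b)`
is bounded below by the contribution of `|ξ| ≥ 3`, the same for all admissible laws, so `n` is
bounded (`exists_le_integral_one_sub_cos`). -/

/-! ### Slowly varying functions -/

/-- Baire category makes the pointwise limit locally uniform: the closed sets `F N` cover the line,
so one of them contains a ball. Comparing two shifts from that ball bounds all small shifts, and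
chaining reaches shifts up to `1`. -/
theorem exists_bound_of_tendsto_shift {h : ℝ → ℝ} (hc : Continuous h)
    (ht : ∀ u, Tendsto (fun v => h (v + u) - h v) atTop (𝓝 0)) :
    ∃ M v₀ : ℝ, ∀ v, v₀ ≤ v → ∀ u, 0 ≤ u → u ≤ 1 → |h (v + u) - h v| ≤ M := by
  let F : ℕ → Set ℝ := fun N => {u | ∀ v : ℝ, (N : ℝ) ≤ v → |h (v + u) - h v| ≤ 1}
  have hF : ∀ N, IsClosed (F N) := by
    intro N
    have : F N = ⋂ v : ℝ, ⋂ _ : (N : ℝ) ≤ v, {u | |h (v + u) - h v| ≤ 1} := by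
      ext u; simp [F]
    rw [this]
    refine isClosed_iInter fun v => isClosed_iInter fun _ => ?_
    exact isClosed_le (by fun_prop) continuous_const
  have hU : ⋃ N, F N = Set.univ := by
    refine Set.eq_univ_of_forall fun u => ?_
    have h1 : ∀ᶠ v in atTop, |h (v + u) - h v| < 1 := by
      have := (ht u).abs
      rw [abs_zero] at this
      exact this.eventually (gt_mem_nhds one_pos)
    obtain ⟨v₁, hv₁⟩ := eventually_atTop.1 h1
    obtain ⟨N, hN⟩ := exists_nat_ge v₁
    exact Set.mem_iUnion.2 ⟨N, fun v hv => (hv₁ v (hN.trans hv)).le⟩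
  obtain ⟨N, a, ha⟩ := nonempty_interior_of_iUnion_of_closed hF hU
  obtain ⟨δ, hδ, hball⟩ := Metric.isOpen_iff.1 isOpen_interior a ha
  have hball' : ∀ w, |w| < δ → a + w ∈ F N := fun w hw =>
    interior_subset (hball (by simpa [Real.dist_eq] using hw))
  -- Both `v + w` and `v` are shifts of the base point `v - a`, by `a + w` and by `a`.
  have step : ∀ v, N + |a| ≤ v → ∀ w, |w| < δ → |h (v + w) - h v| ≤ 2 := by
    intro v hv w hw
    have hva : (N : ℝ) ≤ v - a := by have := le_abs_self a; linarith
    have h1 := hball' w hw (v - a) hva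
    have h2 := hball' 0 (by simpa using hδ) (v - a) hva
    rw [show v - a + (a + w) = v + w by ring] at h1
    rw [show v - a + (a + 0) = v by ring] at h2
    rw [abs_le] at *
    constructor <;> linarith [h1.1, h1.2, h2.1, h2.2]
  have iter : ∀ k : ℕ, ∀ v, N + |a| ≤ v → ∀ w, 0 ≤ w → w ≤ k * (δ / 2) →
      |h (v + w) - h v| ≤ 2 * k := by
    intro k
    induction k with
    | zero =>
      intro v _ w hw0 hw1
      have : w = 0 := by simp at hw1; linarith
      simp [this]
    | succ k ih =>
      intro v hv w hw0 hw1
      push_cast at hw1 ⊢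
      by_cases hw : w ≤ k * (δ / 2)
      · linarith [ih v hv w hw0 hw]
      · push Not at hw
        have hk : 0 ≤ k * (δ / 2) := by positivity
        have h1 := ih v hv (k * (δ / 2)) hk le_rfl
        have h2 := step (v + k * (δ / 2)) (by linarith) (w - k * (δ / 2))
          (by rw [abs_of_pos (by linarith)]; linarith)
        rw [show v + k * (δ / 2) + (w - k * (δ / 2)) = v + w by ring] at h2
        rw [abs_le] at *
        constructor <;> linarith [h1.1, h1.2, h2.1, h2.2]
  obtain ⟨k, hk⟩ := exists_nat_ge (2 / δ)
  refine ⟨2 * k, N + |a|, fun v hv u hu0 hu1 => iter k v hv u hu0 (hu1.trans ?_)⟩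
  rw [div_le_iff₀ hδ] at hk
  linarith

namespace UniformTail

theorem IsSlowlyVarying.exists_ratio_bound {L : ℝ → ℝ} (hL : IsSlowlyVarying L) :
    ∃ C z₀ : ℝ, 1 ≤ C ∧ 1 < z₀ ∧ ∀ s u, z₀ ≤ s → s ≤ u → u ≤ 2 * s →
      L u ≤ C * L s ∧ L s ≤ C * L u := by
  -- In logarithmic coordinates dilations become shifts; the cutoff `max v 1` keeps the argument of
  -- `L` above `1`, so that `h` is continuous on the whole line.
  let h : ℝ → ℝ := fun v => Real.log (L (Real.exp (max v 1)))
  have hexp : ∀ v, 1 < Real.exp (max v 1) := fun v =>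
    Real.one_lt_exp_iff.2 (lt_of_lt_of_le one_pos (le_max_right _ _))
  have hc : Continuous h := by
    have : Continuous fun v => L (Real.exp (max v 1)) :=
      hL.continuousOn.comp_continuous (by fun_prop) hexp
    exact this.log fun v => (hL.pos _ (hexp v)).ne'
  have ht : ∀ u, Tendsto (fun v => h (v + u) - h v) atTop (𝓝 0) := by
    intro u
    have h1 := (hL.tendsto_ratio (Real.exp u) (Real.exp_pos u)).comp Real.tendsto_exp_atTop
    have h2 := (Real.continuousAt_log one_ne_zero).tendsto.comp h1
    rw [Real.log_one] at h2
    refine h2.congr' ?_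
    filter_upwards [eventually_ge_atTop (1 + |u|)] with v hv
    have hv1 : 1 ≤ v := by linarith [abs_nonneg u]
    have hv2 : 1 ≤ v + u := by linarith [neg_abs_le u]
    have e1 := hexp v
    have e2 := hexp (v + u)
    rw [max_eq_left hv1] at e1
    rw [max_eq_left hv2] at e2
    simp only [Function.comp, h, max_eq_left hv1, max_eq_left hv2]
    rw [← Real.exp_add, add_comm u v, Real.log_div (hL.pos _ e2).ne' (hL.pos _ e1).ne']
  obtain ⟨M, v₀, hM⟩ := exists_bound_of_tendsto_shift hc ht
  refine ⟨Real.exp |M|, Real.exp (max v₀ 1), Real.one_le_exp (abs_nonneg _), hexp _, ?_⟩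
  intro s u hs hsu hu
  have hs0 : 0 < s := (Real.exp_pos _).trans_le hs
  have hu0 : 0 < u := hs0.trans_le hsu
  have hls : max v₀ 1 ≤ Real.log s := (Real.le_log_iff_exp_le hs0).2 hs
  have hlu : Real.log s ≤ Real.log u := Real.log_le_log hs0 hsu
  have hlu2 : Real.log u ≤ Real.log s + 1 := by
    have := Real.log_le_log hu0 hu
    rw [Real.log_mul two_ne_zero hs0.ne'] at this
    linarith [Real.log_two_lt_d9]
  have key := hM (Real.log s) ((le_max_left _ _).trans hls) (Real.log u - Real.log s)
    (by linarith) (by linarith)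
  have h1s : 1 ≤ Real.log s := (le_max_right _ _).trans hls
  have hs1 : 1 < s := (hexp _).trans_le hs
  have hLs := hL.pos s hs1
  have hLu := hL.pos u (hs1.trans_le hsu)
  simp only [h, add_sub_cancel, max_eq_left h1s, max_eq_left (h1s.trans hlu),
    Real.exp_log hs0, Real.exp_log hu0] at key
  have key' := abs_le.1 (key.trans (le_abs_self M))
  constructor
  · rw [← Real.log_le_log_iff hLu (by positivity), Real.log_mul (Real.exp_ne_zero _) hLs.ne',
      Real.log_exp]
    linarith [key'.2]
  · rw [← Real.log_le_log_iff hLs (by positivity), Real.log_mul (Real.exp_ne_zero _) hLu.ne',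
      Real.log_exp]
    linarith [key'.1]

/-- Eventually `L (2z) / L z` lies between `1/2` and `2`, so each doubling of `z` changes `L` by at
most a factor two in either direction. Any positive power would do in place of the first. -/
theorem IsSlowlyVarying.exists_linear_bound {L : ℝ → ℝ} (hL : IsSlowlyVarying L) :
    ∃ C z₀ : ℝ, 0 < C ∧ 1 < z₀ ∧ ∀ z, z₀ ≤ z → L z ≤ C * z ∧ 1 ≤ C * z * L z := by
  obtain ⟨C, z₀, hC, hz₀, hr⟩ := hL.exists_ratio_bound
  have h2 := hL.tendsto_ratio 2 two_pos
  have h2a := h2.eventually (gt_mem_nhds (show (1 : ℝ) < 2 by norm_num))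
  have h2b := h2.eventually (lt_mem_nhds (show (1 / 2 : ℝ) < 1 by norm_num))
  obtain ⟨z₁, hz₁⟩ := eventually_atTop.1 (h2a.and h2b)
  set w := max z₀ z₁ with hw
  have hw1 : 1 < w := hz₀.trans_le (le_max_left _ _)
  have hLw := hL.pos w hw1
  set D := max (C * L w) (C / L w) with hD
  have hD0 : 0 < D := lt_of_lt_of_le (by positivity) (le_max_left _ _)
  refine ⟨D, w, hD0, hw1, ?_⟩
  have iter : ∀ k : ℕ, ∀ z, w ≤ z → z ≤ 2 ^ (k + 1) * w → L z ≤ D * z ∧ 1 ≤ D * z * L z := by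
    intro k
    have base : ∀ z, w ≤ z → z ≤ 2 * w → L z ≤ D * z ∧ 1 ≤ D * z * L z := by
      intro z hz hz2
      obtain ⟨ha, hb⟩ := hr w z (le_max_left _ _) hz hz2
      have hz1 : 1 ≤ z := hw1.le.trans hz
      have hLz := hL.pos z (hw1.trans_le hz)
      constructor
      · calc L z ≤ D := ha.trans (le_max_left _ _)
          _ ≤ D * z := le_mul_of_one_le_right hD0.le hz1
      · have : 1 ≤ D * L z := by
          calc (1 : ℝ) = L w / L w := (div_self hLw.ne').symm
            _ ≤ C * L z / L w := by gcongr
            _ = C / L w * L z := by ring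
            _ ≤ D * L z := by gcongr; exact le_max_right _ _
        nlinarith
    induction k with
    | zero => intro z hz hz2; exact base z hz (by simpa using hz2)
    | succ k ih =>
      intro z hz hz2
      by_cases h : z ≤ 2 * w
      · exact base z hz h
      · push Not at h
        have hzw : w ≤ z / 2 := by linarith
        obtain ⟨ha, hb⟩ := ih (z / 2) hzw (by rw [pow_succ] at hz2; linarith)
        obtain ⟨hc, hd⟩ := hz₁ (z / 2) ((le_max_right _ _).trans hzw)
        rw [mul_div_cancel₀ _ (two_ne_zero' ℝ)] at hc hd
        have hL2 := hL.pos (z / 2) (hw1.trans_le hzw)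
        rw [div_lt_iff₀ hL2] at hc
        rw [lt_div_iff₀ hL2] at hd
        refine ⟨by linarith, ?_⟩
        have hDz : 0 ≤ D * z := mul_nonneg hD0.le (by linarith)
        have := mul_le_mul_of_nonneg_left hd.le hDz
        linarith
  intro z hz
  obtain ⟨k, hk⟩ := pow_unbounded_of_one_lt (z / w) (show (1 : ℝ) < 2 by norm_num)
  refine iter k z hz ?_
  rw [div_lt_iff₀ (by linarith)] at hk
  rw [pow_succ]
  nlinarith [pow_pos (show (0 : ℝ) < 2 by norm_num) k]

theorem rpow_mul_ratio_bound {γ C s u Ls Lu : ℝ} (hs : 0 < s) (hsu : s ≤ u)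
    (hu : u ≤ 2 * s) (hLs : 0 < Ls) (hLu : 0 < Lu) (h₁ : Lu ≤ C * Ls) (h₂ : Ls ≤ C * Lu) :
    u ^ γ * Lu ≤ 2 ^ |γ| * C * (s ^ γ * Ls) ∧ s ^ γ * Ls ≤ 2 ^ |γ| * C * (u ^ γ * Lu) := by
  have hu0 : 0 < u := hs.trans_le hsu
  have hr1 : 1 ≤ u / s := (one_le_div hs).2 hsu
  have hr2 : u / s ≤ 2 := (div_le_iff₀ hs).2 hu
  have hb : ∀ δ : ℝ, δ ≤ |γ| → (u / s) ^ δ ≤ 2 ^ |γ| := fun δ hδ =>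
    (Real.rpow_le_rpow_of_exponent_le hr1 hδ).trans
      (Real.rpow_le_rpow (by positivity) hr2 (abs_nonneg _))
  have e1 : u ^ γ = s ^ γ * (u / s) ^ γ := by
    rw [← Real.mul_rpow hs.le (by positivity), mul_div_cancel₀ _ hs.ne']
  have e2 : s ^ γ = u ^ γ * (u / s) ^ (-γ) := by
    rw [e1, mul_assoc, ← Real.rpow_add (by positivity)]; simp
  constructor
  · calc u ^ γ * Lu ≤ (s ^ γ * 2 ^ |γ|) * (C * Ls) := by
          rw [e1]; gcongr; exact hb _ (le_abs_self _)
      _ = _ := by ring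
  · calc s ^ γ * Ls ≤ (u ^ γ * 2 ^ |γ|) * (C * Lu) := by
          rw [e2]; gcongr; exact hb _ (neg_le_abs _)
      _ = _ := by ring

theorem IsSlowlyVarying.exists_rpow_mul_ratio_bound {L : ℝ → ℝ} (hL : IsSlowlyVarying L) (γ : ℝ) :
    ∃ C z₀ : ℝ, 1 ≤ C ∧ 1 < z₀ ∧ ∀ s u, z₀ ≤ s → s ≤ u → u ≤ 2 * s →
      u ^ γ * L u ≤ C * (s ^ γ * L s) ∧ s ^ γ * L s ≤ C * (u ^ γ * L u) := by
  obtain ⟨C, z₀, hC, hz₀, hr⟩ := hL.exists_ratio_bound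
  refine ⟨2 ^ |γ| * C, z₀, ?_, hz₀, fun s u hs hsu hu => ?_⟩
  · exact one_le_mul_of_one_le_of_one_le (Real.one_le_rpow one_le_two (abs_nonneg _)) hC
  · obtain ⟨h₁, h₂⟩ := hr s u hs hsu hu
    exact rpow_mul_ratio_bound (by linarith) hsu hu (hL.pos s (by linarith))
      (hL.pos u (by linarith)) h₁ h₂

/-- The only place where `-1 ≤ γ` matters for the estimates: it lets `t * l t` absorb `1 / t`. -/
theorem IsSlowlyVarying.exists_le_sq_mul {L : ℝ → ℝ} (hL : IsSlowlyVarying L) {γ : ℝ}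
    (hγ : -1 ≤ γ) :
    ∃ c z₀ : ℝ, 0 < c ∧ 1 < z₀ ∧ ∀ t, z₀ ≤ t → c ≤ t ^ 2 * (t ^ γ * L t) := by
  obtain ⟨C, z₀, hC, hz₀, h⟩ := hL.exists_linear_bound
  refine ⟨C⁻¹, z₀, by positivity, hz₀, fun t ht => ?_⟩
  have ht1 : 1 < t := hz₀.trans_le ht
  have hLt := hL.pos t ht1
  have h1 : t ^ (-1 : ℝ) ≤ t ^ γ := Real.rpow_le_rpow_of_exponent_le ht1.le hγ
  have h2 := (h t ht).2
  rw [inv_le_iff_one_le_mul₀ hC]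
  calc (1 : ℝ) ≤ C * t * L t := h2
    _ = t ^ 2 * (t ^ (-1 : ℝ) * L t) * C := by
      rw [Real.rpow_neg_one]; field_simp
    _ ≤ _ := by gcongr

theorem IsSlowlyVarying.exists_rpow_mul_le {L : ℝ → ℝ} (hL : IsSlowlyVarying L) {γ : ℝ}
    (hγ : γ < -1) :
    ∃ C z₀ : ℝ, 0 < C ∧ 1 < z₀ ∧ ∀ t, z₀ ≤ t → t ^ γ * L t ≤ C := by
  obtain ⟨C, z₀, hC, hz₀, h⟩ := hL.exists_linear_bound
  refine ⟨C, z₀, hC, hz₀, fun t ht => ?_⟩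
  have ht1 : 1 < t := hz₀.trans_le ht
  have hLt := hL.pos t ht1
  have h1 : t ^ γ ≤ t ^ (-1 : ℝ) := Real.rpow_le_rpow_of_exponent_le ht1.le hγ.le
  calc t ^ γ * L t ≤ t ^ (-1 : ℝ) * (C * t) := by gcongr; exact (h t ht).1
    _ = C := by rw [Real.rpow_neg_one]; field_simp

/-! ### Growth of the truncated second moment -/

/-- The elementary relations between a tail function `T` and the truncated second moment `V` of
one and the same law. -/
structure TailMoment (T V : ℝ → ℝ) : Prop where
  tail_anti : Antitone T
  tail_nonneg : ∀ y, 0 ≤ T y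
  tail_le_one : ∀ y, T y ≤ 1
  moment_mono : ∀ y z, 0 < y → y ≤ z → V y ≤ V z
  moment_nonneg : ∀ y, 0 ≤ V y
  moment_le : ∀ y, 0 < y → V y ≤ y ^ 2
  le_sub : ∀ y z, 0 < y → y ≤ z → y ^ 2 * (T y - T z) ≤ V z - V y
  sub_le : ∀ y z, 0 < y → y ≤ z → V z - V y ≤ z ^ 2 * T y

/-- Values of `l` at two points within a factor two of each other, beyond `s₀`, are comparable. -/
def DoublingComparable (l : ℝ → ℝ) (C s₀ : ℝ) : Prop :=
  ∀ s u, s₀ ≤ s → s ≤ u → u ≤ 2 * s → l u ≤ C * l s ∧ l s ≤ C * l u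

/-- The shell from `e^u` to `e^(u+a)` is wide enough (`e^a = 2C`) for the tail at its outer end to
be at most half the tail at its inner end. -/
theorem TailMoment.half_le_moment_sub {l T V : ℝ → ℝ} {C a s₀ u : ℝ}
    (hpos : ∀ z, 1 < z → 0 < l z) (hC : 1 ≤ C) (hs₀ : 1 < s₀) (hl : DoublingComparable l C s₀)
    (ha : Real.exp a = 2 * C) (hTV : TailMoment T V)
    (hT : ∀ u, 1 < u → T (Real.exp u) * Real.exp u ^ 2 = l u) (ha0 : 0 ≤ a) (hu : s₀ ≤ u)
    (hau : a ≤ u) : l u / 2 ≤ V (Real.exp (u + a)) - V (Real.exp u) := by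
  have h1 := hTV.le_sub _ _ (Real.exp_pos u) (Real.exp_le_exp.2 (by linarith : u ≤ u + a))
  have h2 := hT u (by linarith)
  have h3 := hT (u + a) (by linarith)
  have h4 := (hl u (u + a) hu (by linarith) (by linarith)).1
  have h3' : Real.exp (u + a) ^ 2 = Real.exp u ^ 2 * (4 * C ^ 2) := by
    rw [Real.exp_add, ha]; ring
  rw [h3'] at h3
  have h5 := hpos u (by linarith)
  have h6 : Real.exp u ^ 2 * T (Real.exp (u + a)) * (4 * C ^ 2) ≤ C * l u := by
    calc _ = _ := by ring
      _ = l (u + a) := h3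
      _ ≤ _ := h4
  have h7 : 0 ≤ Real.exp u ^ 2 * T (Real.exp (u + a)) :=
    mul_nonneg (by positivity) (hTV.tail_nonneg _)
  have h8 : Real.exp u ^ 2 * T (Real.exp (u + a)) ≤ l u / 2 := by
    have h9 : Real.exp u ^ 2 * T (Real.exp (u + a)) * (4 * C) ≤ l u :=
      le_of_mul_le_mul_left (by linarith) (by linarith : 0 < C)
    nlinarith [mul_le_mul_of_nonneg_left hC h7]
  linarith

/-- About `s / (2a)` disjoint shells fit between `e^(s/2)` and `e^s`, each contributing at least a
multiple of `l s`; hence the lower bound `s * l s`. One further shell adds at most `(2C)² l s`,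
which this lower bound dominates for large `s`, so `V` at most doubles while its argument is
multiplied by `e^a = 2C ≥ 2`: growth is at most linear. -/
theorem TailMoment.exists_growth_constants {l : ℝ → ℝ} {C s₀ : ℝ}
    (hpos : ∀ z, 1 < z → 0 < l z) (hC : 1 ≤ C) (hs₀ : 1 < s₀) (hl : DoublingComparable l C s₀) :
    ∃ c D s₁ : ℝ, 0 < c ∧ 0 < D ∧ 2 ≤ s₁ ∧ s₀ ≤ s₁ ∧
      ∀ T V : ℝ → ℝ, TailMoment T V → (∀ u, 1 < u → T (Real.exp u) * Real.exp u ^ 2 = l u) →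
      ∀ s, s₁ ≤ s → c ≤ V (Real.exp s) ∧ c * (s * l s) ≤ V (Real.exp s) ∧
        ∀ t, 0 ≤ t → V (Real.exp (s + t)) ≤ D * Real.exp t * V (Real.exp s) := by
  set a := Real.log (2 * C) with ha_def
  have ha : Real.exp a = 2 * C := Real.exp_log (by linarith)
  have ha0 : 0 < a := Real.log_pos (by linarith)
  set S := max (max (2 * s₀) (4 * a)) 2 with hS
  have hS1 : 2 * s₀ ≤ S := (le_max_left _ _).trans (le_max_left _ _)
  have hS2 : 4 * a ≤ S := (le_max_right _ _).trans (le_max_left _ _)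
  have hS3 : 2 ≤ S := le_max_right _ _
  -- The number of shells is at least `s / (4a)` and each gives `l s / (2C)`.
  set d := 1 / (8 * a * C) with hd_def
  have hd : 0 < d := by positivity
  have hlow : ∀ T V : ℝ → ℝ, TailMoment T V →
      (∀ u, 1 < u → T (Real.exp u) * Real.exp u ^ 2 = l u) →
      ∀ s, S ≤ s → d * (s * l s) ≤ V (Real.exp s) := by
    intro T V hTV hT s hs
    have iter : ∀ j : ℕ, j * a ≤ s / 2 →
        j * (l s / (2 * C)) ≤ V (Real.exp s) - V (Real.exp (s - j * a)) := by
      intro j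
      induction j with
      | zero => intro _; simp
      | succ j ih =>
        intro hj
        push_cast at hj ⊢
        have hja : 0 ≤ j * a := by positivity
        have h1 := ih (by linarith)
        have h2 := hTV.half_le_moment_sub (u := s - (j + 1) * a) hpos hC hs₀ hl ha hT ha0.le
          (by linarith) (by linarith)
        rw [show s - (j + 1) * a + a = s - j * a by ring] at h2
        have h3 := (hl (s - (j + 1) * a) s (by linarith) (by linarith) (by linarith)).1
        have h4 : l s / (2 * C) ≤ l (s - (j + 1) * a) / 2 := by
          rw [div_le_div_iff₀ (by linarith) two_pos]; linarith
        linarith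
    set j := ⌊s / (2 * a)⌋₊ with hj
    have hj1 : (j : ℝ) * a ≤ s / 2 := by
      have := Nat.floor_le (show 0 ≤ s / (2 * a) by apply div_nonneg <;> linarith)
      rw [le_div_iff₀ (by positivity)] at this
      linarith
    have hj2 : s ≤ 4 * a * j := by
      have := Nat.lt_floor_add_one (s / (2 * a))
      rw [div_lt_iff₀ (by positivity)] at this
      linarith
    have h1 := iter j hj1
    have h2 := hTV.moment_nonneg (Real.exp (s - j * a))
    have h3 := hpos s (by linarith)
    calc d * (s * l s) ≤ d * (4 * a * j * l s) := by gcongr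
      _ = j * (l s / (2 * C)) := by rw [hd_def]; field_simp; ring
      _ ≤ V (Real.exp s) := by linarith
  set s₁ := max S ((2 * C) ^ 2 / d) with hs₁
  have hSs : S ≤ s₁ := le_max_left _ _
  have hds : (2 * C) ^ 2 / d ≤ s₁ := le_max_right _ _
  have hl₁ := hpos s₁ (by linarith)
  refine ⟨min d (d * (s₁ * l s₁)), 2 * C, s₁, lt_min hd ?_, by linarith, by linarith, by linarith,
    fun T V hTV hT s hs => ⟨?_, ?_, ?_⟩⟩
  · have : 0 < s₁ := by linarith
    positivity
  · exact (min_le_right _ _).trans ((hlow T V hTV hT s₁ hSs).trans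
      (hTV.moment_mono _ _ (Real.exp_pos _) (Real.exp_le_exp.2 hs)))
  · refine le_trans ?_ (hlow T V hTV hT s (hSs.trans hs))
    have := hpos s (by linarith)
    exact mul_le_mul_of_nonneg_right (min_le_left _ _) (mul_nonneg (by linarith) this.le)
  · have step : ∀ u, s₁ ≤ u → V (Real.exp (u + a)) ≤ 2 * C * V (Real.exp u) := by
      intro u hu
      have h1 := hTV.sub_le _ _ (Real.exp_pos u) (Real.exp_le_exp.2 (by linarith : u ≤ u + a))
      have h2 := hT u (by linarith)
      have h3 := hlow T V hTV hT u (hSs.trans hu)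
      have h4 := hpos u (by linarith)
      have h5 : Real.exp (u + a) ^ 2 * T (Real.exp u) = (2 * C) ^ 2 * l u := by
        rw [Real.exp_add, ha, ← h2]; ring
      have h6 : (2 * C) ^ 2 ≤ d * u := by
        have := hds.trans hu
        rw [div_le_iff₀ hd] at this
        linarith
      have h7 : (2 * C) ^ 2 * l u ≤ d * u * l u := by gcongr
      have h8 := hTV.moment_nonneg (Real.exp u)
      nlinarith
    have iter : ∀ k : ℕ, V (Real.exp (s + k * a)) ≤ (2 * C) ^ k * V (Real.exp s) := by
      intro k
      induction k with
      | zero => simp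
      | succ k ih =>
        have hka : 0 ≤ k * a := by positivity
        have h1 := step (s + k * a) (by linarith)
        rw [show s + ((k + 1 : ℕ) : ℝ) * a = s + k * a + a by push_cast; ring]
        calc _ ≤ _ := h1
          _ ≤ 2 * C * ((2 * C) ^ k * V (Real.exp s)) := by gcongr
          _ = _ := by ring
    intro t ht
    set k := ⌈t / a⌉₊ with hk
    have hk1 : t ≤ k * a := by
      have := Nat.le_ceil (t / a)
      rwa [div_le_iff₀ ha0] at this
    have hk2 : k * a ≤ t + a := by
      have := (Nat.ceil_lt_add_one (show 0 ≤ t / a by positivity)).le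
      rw [← hk] at this
      calc k * a ≤ (t / a + 1) * a := by gcongr
        _ = t + a := by field_simp
    have hV := hTV.moment_nonneg (Real.exp s)
    calc V (Real.exp (s + t)) ≤ V (Real.exp (s + k * a)) :=
          hTV.moment_mono _ _ (Real.exp_pos _) (Real.exp_le_exp.2 (by linarith))
      _ ≤ (2 * C) ^ k * V (Real.exp s) := iter k
      _ = Real.exp (k * a) * V (Real.exp s) := by rw [Real.exp_nat_mul, ha]
      _ ≤ Real.exp (t + a) * V (Real.exp s) := by gcongr
      _ = _ := by rw [Real.exp_add, ha]; ring

/-! ### Consequences of the norming for moments and tails -/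

/-- The two regimes for the number `n` of summands and the norming constant `b`. -/
def NormingBound (V : ℝ → ℝ) (β N s₁ : ℝ) (n : ℕ) (b : ℝ) : Prop :=
  β ≤ b ∧ ((b ≤ Real.exp s₁ ∧ (n : ℝ) ≤ N) ∨ (Real.exp s₁ ≤ b ∧ n * V b ≤ 5 * b ^ 2))

/-- The conclusions of `TailMoment.exists_growth_constants`. -/
structure GrowthBound (l V : ℝ → ℝ) (c D s₁ : ℝ) : Prop where
  le_moment : ∀ s, s₁ ≤ s → c ≤ V (Real.exp s)
  mul_le_moment : ∀ s, s₁ ≤ s → c * (s * l s) ≤ V (Real.exp s)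
  moment_add_le : ∀ s, s₁ ≤ s → ∀ t, 0 ≤ t →
    V (Real.exp (s + t)) ≤ D * Real.exp t * V (Real.exp s)

theorem NormingBound.natCast_le {l V : ℝ → ℝ} {β N c D s₁ b : ℝ} {n : ℕ} (hβ : 0 < β)
    (hN : 0 ≤ N) (hc : 0 < c) (hG : GrowthBound l V c D s₁) (h : NormingBound V β N s₁ n b) :
    (n : ℝ) ≤ (N / β ^ 2 + 5 / c) * b ^ 2 := by
  obtain ⟨hb, ⟨h1, h2⟩ | ⟨h1, h2⟩⟩ := h
  · have : N ≤ N / β ^ 2 * b ^ 2 := by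
      calc N = N / β ^ 2 * β ^ 2 := by field_simp
        _ ≤ _ := by gcongr
    have : 0 ≤ 5 / c * b ^ 2 := by positivity
    linarith
  · have hb0 : 0 < b := hβ.trans_le hb
    have h3 := hG.le_moment (Real.log b) ((Real.le_log_iff_exp_le hb0).2 h1)
    rw [Real.exp_log hb0] at h3
    have h4 : n * c ≤ 5 * b ^ 2 := le_trans (by gcongr) h2
    have h5 : (n : ℝ) ≤ 5 / c * b ^ 2 := by
      rw [div_mul_eq_mul_div, le_div_iff₀ hc]; exact h4
    have : 0 ≤ N / β ^ 2 * b ^ 2 := by positivity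
    linarith

/-- Linear growth of `V` against the square of `x * b` leaves a factor `1 / x`, which suffices
because the exponential inequality cubes it. -/
theorem NormingBound.mul_moment_le {l T V : ℝ → ℝ} {β N c D s₁ b x : ℝ} {n : ℕ} (hβ : 0 < β)
    (hN : 0 ≤ N) (hD : 0 < D) (hTV : TailMoment T V) (hG : GrowthBound l V c D s₁)
    (h : NormingBound V β N s₁ n b) (hx : 1 ≤ x) :
    n * V (x * b / 6) ≤
      (36 * (N * (D * Real.exp s₁ ^ 2) / β ^ 2 + 5 * D) / x) * (x * b / 6) ^ 2 := by
  obtain ⟨hb, h⟩ := h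
  have hb0 : 0 < b := hβ.trans_le hb
  have hx0 : 0 < x := one_pos.trans_le hx
  have hmul : ∀ s, s₁ ≤ s → V (x * Real.exp s) ≤ D * x * V (Real.exp s) := by
    intro s hs
    have := hG.moment_add_le s hs (Real.log x) (Real.log_nonneg hx)
    rwa [Real.exp_add, Real.exp_log hx0, mul_comm (Real.exp s)] at this
  have hgoal : (36 * (N * (D * Real.exp s₁ ^ 2) / β ^ 2 + 5 * D) / x) * (x * b / 6) ^ 2 =
      N * (D * Real.exp s₁ ^ 2) * x * (b ^ 2 / β ^ 2) + 5 * D * x * b ^ 2 := by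
    field_simp
    ring
  rw [hgoal]
  have hp1 : 0 ≤ N * (D * Real.exp s₁ ^ 2) * x * (b ^ 2 / β ^ 2) := by positivity
  have hp2 : 0 ≤ 5 * D * x * b ^ 2 := by positivity
  rcases h with ⟨h1, h2⟩ | ⟨h1, h2⟩
  · have h3 : V (x * b / 6) ≤ D * x * Real.exp s₁ ^ 2 := by
      calc V (x * b / 6) ≤ V (x * Real.exp s₁) := by
            refine hTV.moment_mono _ _ (by positivity) ?_
            have : x * b ≤ x * Real.exp s₁ := by gcongr
            have : 0 < x * b := by positivity
            linarith
        _ ≤ D * x * V (Real.exp s₁) := hmul s₁ le_rfl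
        _ ≤ _ := by gcongr; exact hTV.moment_le _ (Real.exp_pos _)
    have h4 : 1 ≤ b ^ 2 / β ^ 2 := by
      rw [one_le_div (by positivity)]; gcongr
    calc n * V (x * b / 6) ≤ N * (D * x * Real.exp s₁ ^ 2) :=
          mul_le_mul h2 h3 (hTV.moment_nonneg _) hN
      _ = N * (D * Real.exp s₁ ^ 2) * x * 1 := by ring
      _ ≤ N * (D * Real.exp s₁ ^ 2) * x * (b ^ 2 / β ^ 2) := by gcongr
      _ ≤ _ := by linarith
  · have h3 := hmul (Real.log b) ((Real.le_log_iff_exp_le hb0).2 h1)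
    rw [Real.exp_log hb0] at h3
    have h4 : V (x * b / 6) ≤ V (x * b) := by
      refine hTV.moment_mono _ _ (by positivity) ?_
      have : 0 < x * b := by positivity
      linarith
    calc n * V (x * b / 6) ≤ n * (D * x * V b) := by gcongr; exact h4.trans h3
      _ = D * x * (n * V b) := by ring
      _ ≤ D * x * (5 * b ^ 2) := by gcongr
      _ ≤ _ := by linarith

theorem NormingBound.mul_tail_le_of_le {l T V : ℝ → ℝ} {β N c D s₁ b x K z₀ : ℝ} {n : ℕ}
    (hβ : 0 < β) (hN : 0 ≤ N) (hc : 0 < c) (hTV : TailMoment T V) (hG : GrowthBound l V c D s₁)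
    (hT : ∀ u, 1 < u → T (Real.exp u) * Real.exp u ^ 2 = l u) (hz₀ : 1 < z₀) (hK : 0 < K)
    (hl : ∀ t, z₀ ≤ t → l t ≤ K) (h : NormingBound V β N s₁ n b) (hx : 1 ≤ x) :
    n * T (x * b / 6) * x ^ 2 ≤ 36 * (N / β ^ 2 + 5 / c) * (Real.exp z₀ ^ 2 + K) := by
  have hb0 : 0 < b := hβ.trans_le h.1
  have hx0 : 0 < x := one_pos.trans_le hx
  have hn := h.natCast_le hβ hN hc hG
  have hy : ∀ y, 0 < y → T y * y ^ 2 ≤ Real.exp z₀ ^ 2 + K := by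
    intro y hy
    by_cases hyz : y ≤ Real.exp z₀
    · calc T y * y ^ 2 ≤ 1 * Real.exp z₀ ^ 2 := by gcongr; exact hTV.tail_le_one y
        _ ≤ _ := by linarith
    · push Not at hyz
      have h1 : z₀ ≤ Real.log y := (Real.le_log_iff_exp_le hy).2 hyz.le
      have h2 := hT (Real.log y) (by linarith)
      rw [Real.exp_log hy] at h2
      rw [h2]
      have := hl _ h1
      have := sq_nonneg (Real.exp z₀)
      linarith
  have h1 := hy (x * b / 6) (by positivity)
  have h2 := hTV.tail_nonneg (x * b / 6)
  calc n * T (x * b / 6) * x ^ 2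
      ≤ ((N / β ^ 2 + 5 / c) * b ^ 2) * T (x * b / 6) * x ^ 2 := by gcongr
    _ = 36 * (N / β ^ 2 + 5 / c) * (T (x * b / 6) * (x * b / 6) ^ 2) := by ring
    _ ≤ _ := by gcongr

/-- For bounded `b` the tail at `x * b / 6` is comparable to that at `x`. For large `b` the larger
of `log b` and `log x` decides the size of `l`; the three summands of the constant belong to these
three cases. -/
theorem NormingBound.mul_tail_le_of_ge {l T V : ℝ → ℝ} {β N c D s₁ b x κ z₀ C s₀ d : ℝ} {n : ℕ}
    (hpos : ∀ z, 1 < z → 0 < l z) (hC : 1 ≤ C) (hs₀ : 1 < s₀) (hl : DoublingComparable l C s₀)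
    (hβ : 0 < β) (hN : 0 ≤ N) (hc : 0 < c) (hs₁ : 2 ≤ s₁)
    (hTV : TailMoment T V) (hG : GrowthBound l V c D s₁)
    (hT : ∀ u, 1 < u → T (Real.exp u) * Real.exp u ^ 2 = l u) (hκ : 0 < κ)
    (hlt : ∀ t, z₀ ≤ t → κ ≤ t ^ 2 * l t) (h : NormingBound V β N s₁ n b)
    (hd : 0 ≤ d) (hdβ : Real.exp (-d) ≤ β / 6) (hx0 : 0 < x) (hx1 : s₀ + 2 * d + 2 ≤ Real.log x)
    (hx2 : z₀ ≤ Real.log x) :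
    n * T (x * b / 6) * x ^ 2 ≤
      (N * C * Real.exp d ^ 2 + 180 * C / c + 180 * C / c / κ) * (Real.log x * l (Real.log x)) := by
  obtain ⟨hb, h⟩ := h
  have hb0 : 0 < b := hβ.trans_le hb
  set t := Real.log x with ht
  have hxt : x = Real.exp t := (Real.exp_log hx0).symm
  have hlt0 := hpos t (by linarith)
  have htl : l t ≤ t * l t := le_mul_of_one_le_left hlt0.le (by linarith)
  have ht0 : 0 < t := by linarith
  have hp1 : 0 ≤ N * C * Real.exp d ^ 2 * (t * l t) := by positivity
  have hp2 : 0 ≤ 180 * C / c * (t * l t) := by positivity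
  have hp3 : 0 ≤ 180 * C / c / κ * (t * l t) := by positivity
  rcases h with ⟨h1, h2⟩ | ⟨h1, h2⟩
  · have h3 : T (x * b / 6) ≤ T (Real.exp (t - d)) := by
      refine hTV.tail_anti ?_
      rw [sub_eq_add_neg, Real.exp_add, ← hxt, mul_div_assoc]
      gcongr
      exact hdβ.trans (by gcongr)
    have h4 := hT (t - d) (by linarith)
    have h5 := (hl (t - d) t (by linarith) (by linarith) (by linarith)).2
    have h6 : T (Real.exp (t - d)) * x ^ 2 = l (t - d) * Real.exp d ^ 2 := by
      rw [← h4, hxt, mul_assoc, ← mul_pow, ← Real.exp_add]; simp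
    calc n * T (x * b / 6) * x ^ 2 ≤ N * T (Real.exp (t - d)) * x ^ 2 := by
          gcongr; exact hTV.tail_nonneg _
      _ = N * (l (t - d) * Real.exp d ^ 2) := by rw [mul_assoc, h6]
      _ ≤ N * (C * (t * l t) * Real.exp d ^ 2) := by
          gcongr
          exact h5.trans (by gcongr)
      _ = N * C * Real.exp d ^ 2 * (t * l t) := by ring
      _ ≤ _ := by linarith
  · set s := Real.log b with hs
    have hss : s₁ ≤ s := (Real.le_log_iff_exp_le hb0).2 h1
    have hbs : Real.exp s = b := Real.exp_log hb0
    have h6a : 0 ≤ Real.log 6 := Real.log_nonneg (by norm_num)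
    -- Since `s` and `t` are both at least `2`, this places `s + t - log 6` between `max s t` and `2
    -- * max s t`, within the range of doubling comparability.
    have h6b : Real.log 6 ≤ 2 := by
      rw [Real.log_le_iff_le_exp (by norm_num), show (2 : ℝ) = 1 + 1 by norm_num, Real.exp_add]
      nlinarith [Real.exp_one_gt_d9]
    have hy : x * b / 6 = Real.exp (s + t - Real.log 6) := by
      rw [Real.exp_sub, Real.exp_add, Real.exp_log (by norm_num : (0 : ℝ) < 6), hbs, ← hxt]
      ring
    have h3 := hT (s + t - Real.log 6) (by linarith)
    rw [← hy] at h3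
    have h4 : n * T (x * b / 6) * x ^ 2 = 36 * (n * l (s + t - Real.log 6)) / b ^ 2 := by
      rw [← h3]; field_simp; ring
    rw [h4, div_le_iff₀ (by positivity)]
    have hb2 : 0 < b ^ 2 := by positivity
    by_cases hst : s ≤ t
    · have h5 := (hl t (s + t - Real.log 6) (by linarith) (by linarith) (by linarith)).1
      have h7 := hG.le_moment s hss
      rw [hbs] at h7
      have h8 : n * c ≤ 5 * b ^ 2 := le_trans (by gcongr) h2
      have h9 : (n : ℝ) ≤ 5 / c * b ^ 2 := by
        rw [div_mul_eq_mul_div, le_div_iff₀ hc]; exact h8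
      calc 36 * (n * l (s + t - Real.log 6)) ≤ 36 * ((5 / c * b ^ 2) * (C * (t * l t))) := by
            have h10 : l (s + t - Real.log 6) ≤ C * (t * l t) := h5.trans (by gcongr)
            have := hpos (s + t - Real.log 6) (by linarith)
            gcongr
        _ = 180 * C / c * (t * l t) * b ^ 2 := by ring
        _ ≤ _ := mul_le_mul_of_nonneg_right (by linarith) hb2.le
    · push Not at hst
      have h5 := (hl s (s + t - Real.log 6) (by linarith) (by linarith) (by linarith)).1
      have h7 := hG.mul_le_moment s hss
      rw [hbs] at h7
      have hls := hpos s (by linarith)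
      -- The moment bound has `s * l s`; weakening `s` to `t < s` makes the estimate uniform in `b`.
      have h8 : n * (c * (t * l s)) ≤ 5 * b ^ 2 := by
        refine le_trans ?_ h2
        gcongr
        exact le_trans (by gcongr) h7
      have h9 : n * l s ≤ 5 / c * b ^ 2 / t := by
        rw [le_div_iff₀ ht0, div_mul_eq_mul_div, le_div_iff₀ hc]
        linarith
      have h10 : 1 / t ≤ t * l t / κ := by
        rw [div_le_div_iff₀ ht0 hκ]
        have := hlt t hx2
        linarith
      calc 36 * (n * l (s + t - Real.log 6)) ≤ 36 * (n * (C * l s)) := by gcongr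
        _ = 36 * C * (n * l s) := by ring
        _ ≤ 36 * C * (5 / c * b ^ 2 / t) := by gcongr
        _ = 180 * C / c * b ^ 2 * (1 / t) := by ring
        _ ≤ 180 * C / c * b ^ 2 * (t * l t / κ) := by gcongr
        _ = 180 * C / c / κ * (t * l t) * b ^ 2 := by ring
        _ ≤ _ := mul_le_mul_of_nonneg_right (by linarith) hb2.le

/-! ### Truncated laws -/

/-- Truncation to the open interval `(-y, y)`. -/
noncomputable def cut (y x : ℝ) : ℝ := if |x| < y then x else 0

/-- The truncated second moment of a law on the line. -/
noncomputable def truncMoment (μ : Measure ℝ) (y : ℝ) : ℝ := ∫ x, cut y x ^ 2 ∂μ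

theorem measurable_cut (y : ℝ) : Measurable (cut y) :=
  Measurable.ite (measurableSet_lt (by fun_prop) measurable_const) measurable_id measurable_const

theorem abs_cut_le {y : ℝ} (hy : 0 ≤ y) (x : ℝ) : |cut y x| ≤ y := by
  unfold cut; split_ifs with h
  · exact h.le
  · simpa using hy

theorem cut_neg (y x : ℝ) : cut y (-x) = -cut y x := by
  unfold cut; simp only [abs_neg]; split_ifs <;> simp

theorem integrable_cut_sq (μ : Measure ℝ) [IsFiniteMeasure μ] (y : ℝ) :
    Integrable (fun x => cut y x ^ 2) μ := by
  refine Integrable.of_bound ((measurable_cut y).pow_const 2).aestronglyMeasurable (y ^ 2)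
    (ae_of_all _ fun x => ?_)
  rw [Real.norm_eq_abs, abs_of_nonneg (sq_nonneg _)]
  unfold cut; split_ifs with h
  · rw [← sq_abs]; gcongr
  · simpa using sq_nonneg y

theorem measurableSet_le_abs (y : ℝ) : MeasurableSet {x : ℝ | y ≤ |x|} :=
  measurableSet_le measurable_const (by fun_prop)

theorem integral_const_mul_indicator_tail (μ : Measure ℝ) (c y : ℝ) :
    ∫ x, c * {x : ℝ | y ≤ |x|}.indicator (fun _ => (1 : ℝ)) x ∂μ = c * μ.real {x | y ≤ |x|} := by
  rw [integral_const_mul, integral_indicator (measurableSet_le_abs y)]; simp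

theorem integrable_indicator_tail (μ : Measure ℝ) [IsFiniteMeasure μ] (y : ℝ) :
    Integrable ({x : ℝ | y ≤ |x|}.indicator (fun _ => (1 : ℝ))) μ :=
  (integrable_const 1).indicator (measurableSet_le_abs y)

theorem tailMoment_truncMoment (μ : Measure ℝ) [IsProbabilityMeasure μ] :
    TailMoment (fun y => μ.real {x | y ≤ |x|}) (truncMoment μ) where
  tail_anti y z hyz := measureReal_mono fun x (hx : z ≤ |x|) => hyz.trans hx
  tail_nonneg y := measureReal_nonneg
  tail_le_one y := measureReal_le_one
  moment_nonneg y := integral_nonneg fun x => sq_nonneg _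
  moment_mono y z hy hyz := by
    refine integral_mono (integrable_cut_sq μ y) (integrable_cut_sq μ z) fun x => ?_
    simp only [cut]
    split_ifs with h1 h2
    · rfl
    · linarith
    · simpa using sq_nonneg x
    · rfl
  moment_le y hy := by
    have := integral_mono (integrable_cut_sq μ y) (integrable_const (y ^ 2)) fun x => by
      have := abs_cut_le hy.le x
      show cut y x ^ 2 ≤ y ^ 2
      rw [← sq_abs]; gcongr
    simpa [truncMoment] using this
  le_sub y z hy hyz := by
    rw [mul_sub, ← integral_const_mul_indicator_tail, ← integral_const_mul_indicator_tail,
      truncMoment, truncMoment,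
      ← integral_sub ((integrable_indicator_tail μ y).const_mul _)
        ((integrable_indicator_tail μ z).const_mul _),
      ← integral_sub (integrable_cut_sq μ z) (integrable_cut_sq μ y)]
    refine integral_mono (((integrable_indicator_tail μ y).const_mul _).sub
        ((integrable_indicator_tail μ z).const_mul _))
      ((integrable_cut_sq μ z).sub (integrable_cut_sq μ y)) fun x => ?_
    simp only [cut, Set.indicator, Set.mem_ofPred_eq]
    by_cases h1 : |x| < y
    · simp [h1, h1.trans_le hyz, h1.not_ge, (h1.trans_le hyz).not_ge]
    · by_cases h2 : |x| < z
      · have h3 : y ^ 2 ≤ x ^ 2 := by rw [← sq_abs x]; push Not at h1; gcongr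
        simpa [h1, h2, h2.not_ge, not_lt.1 h1] using h3
      · simp [h1, h2, not_lt.1 h1, not_lt.1 h2]
  sub_le y z hy hyz := by
    rw [← integral_const_mul_indicator_tail, truncMoment, truncMoment,
      ← integral_sub (integrable_cut_sq μ z) (integrable_cut_sq μ y)]
    refine integral_mono ((integrable_cut_sq μ z).sub (integrable_cut_sq μ y))
      ((integrable_indicator_tail μ y).const_mul _) fun x => ?_
    simp only [cut, Set.indicator, Set.mem_ofPred_eq]
    by_cases h1 : |x| < y
    · simp [h1, h1.trans_le hyz, h1.not_ge]
    · by_cases h2 : |x| < z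
      · have h3 : x ^ 2 ≤ z ^ 2 := by rw [← sq_abs x]; gcongr
        simpa [h1, h2, not_lt.1 h1] using h3
      · simpa [h1, h2, not_lt.1 h1] using sq_nonneg z

/-! ### Exponential inequality for sums -/

theorem exp_le_one_add_add_sq_mul (u : ℝ) :
    Real.exp u ≤ 1 + u + u ^ 2 * Real.exp |u| := by
  have h := Complex.norm_exp_sub_sum_le_norm_mul_exp (u : ℂ) 2
  have e : Complex.exp u - ∑ m ∈ Finset.range 2, (u : ℂ) ^ m / (m.factorial : ℂ) =
      ((Real.exp u - (1 + u) : ℝ) : ℂ) := by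
    simp [Finset.sum_range_succ]
  rw [e, Complex.norm_real, Complex.norm_real, Real.norm_eq_abs, Real.norm_eq_abs, sq_abs] at h
  linarith [le_abs_self (Real.exp u - (1 + u))]

theorem integrable_cut (μ : Measure ℝ) [IsFiniteMeasure μ] {y : ℝ} (hy : 0 ≤ y) :
    Integrable (cut y) μ :=
  Integrable.of_bound (measurable_cut y).aestronglyMeasurable y (ae_of_all _ (abs_cut_le hy))

theorem integral_cut_eq_zero {μ : Measure ℝ} (hμ : μ.map Neg.neg = μ) (y : ℝ) :
    ∫ x, cut y x ∂μ = 0 := by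
  have h : ∫ x, cut y x ∂μ = ∫ x, cut y (-x) ∂μ := by
    conv_lhs => rw [← hμ]
    exact integral_map measurable_neg.aemeasurable (measurable_cut y).aestronglyMeasurable
  simp only [cut_neg, integral_neg] at h
  linarith

/-- Symmetry removes the linear term of the second-order expansion of the exponential. -/
theorem integral_exp_cut_le {μ : Measure ℝ} [IsProbabilityMeasure μ] (hμ : μ.map Neg.neg = μ)
    {y : ℝ} (hy : 0 ≤ y) (t : ℝ) :
    ∫ x, Real.exp (t * cut y x) ∂μ ≤
      Real.exp (t ^ 2 * Real.exp (|t| * y) * truncMoment μ y) := by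
  have hint : Integrable (fun x => 1 + t * cut y x + t ^ 2 * Real.exp (|t| * y) * cut y x ^ 2) μ :=
    ((integrable_const 1).add ((integrable_cut μ hy).const_mul t)).add
      ((integrable_cut_sq μ y).const_mul _)
  have hle : ∀ x, Real.exp (t * cut y x) ≤
      1 + t * cut y x + t ^ 2 * Real.exp (|t| * y) * cut y x ^ 2 := by
    intro x
    have h1 := exp_le_one_add_add_sq_mul (t * cut y x)
    have h2 : Real.exp |t * cut y x| ≤ Real.exp (|t| * y) := by
      rw [abs_mul]; gcongr; exact abs_cut_le hy x
    have h3 := mul_le_mul_of_nonneg_left h2 (sq_nonneg (t * cut y x))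
    rw [mul_pow] at h1 h3
    linarith
  calc ∫ x, Real.exp (t * cut y x) ∂μ
      ≤ ∫ x, (1 + t * cut y x + t ^ 2 * Real.exp (|t| * y) * cut y x ^ 2) ∂μ :=
        integral_mono_of_nonneg (ae_of_all _ fun x => (Real.exp_pos _).le) hint (ae_of_all _ hle)
    _ = 1 + t ^ 2 * Real.exp (|t| * y) * truncMoment μ y := by
        have e1 := integral_add (f := fun x => 1 + t * cut y x)
          ((integrable_const 1).add ((integrable_cut μ hy).const_mul t))
          ((integrable_cut_sq μ y).const_mul (t ^ 2 * Real.exp (|t| * y)))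
        have e2 := integral_add (f := fun _ => (1 : ℝ)) (integrable_const 1)
          ((integrable_cut μ hy).const_mul t)
        rw [e1, e2, integral_const_mul, integral_const_mul, integral_cut_eq_zero hμ]
        simp [truncMoment]
    _ ≤ _ := by linarith [Real.add_one_le_exp (t ^ 2 * Real.exp (|t| * y) * truncMoment μ y)]

variable {Ω : Type*} [MeasurableSpace Ω]

theorem mgf_sum_cut_le {P : Measure Ω} [IsProbabilityMeasure P] {ξ : ℕ → Ω → ℝ} {μ : Measure ℝ}
    (hind : iIndepFun ξ P) (hmeas : ∀ k, AEMeasurable (ξ k) P) (hmap : ∀ k, P.map (ξ k) = μ)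
    (hμ : μ.map Neg.neg = μ) (n : ℕ) {y : ℝ} (hy : 0 ≤ y) (t : ℝ) :
    mgf (∑ k ∈ range n, cut y ∘ ξ k) P t ≤
      Real.exp (n * (t ^ 2 * Real.exp (|t| * y) * truncMoment μ y)) := by
  have hprob : IsProbabilityMeasure μ := by
    rw [← hmap 0]; exact Measure.isProbabilityMeasure_map (hmeas 0)
  have hind' : iIndepFun (fun k => cut y ∘ ξ k) P :=
    hind.comp (fun _ => cut y) fun _ => measurable_cut y
  rw [hind'.mgf_sum₀ fun k => (measurable_cut y).comp_aemeasurable (hmeas k), Real.exp_nat_mul]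
  refine (Finset.prod_le_prod (fun _ _ => mgf_nonneg) fun k _ => ?_).trans_eq
    (by rw [Finset.prod_const, Finset.card_range])
  have : mgf (cut y ∘ ξ k) P t = ∫ x, Real.exp (t * cut y x) ∂μ := by
    rw [← hmap k, integral_map (hmeas k)
      ((measurable_cut y).const_mul t).exp.aestronglyMeasurable]
    rfl
  rw [this]
  exact integral_exp_cut_le hμ hy t

theorem measureReal_abs_sum_cut_le {P : Measure Ω} [IsProbabilityMeasure P] {ξ : ℕ → Ω → ℝ}
    {μ : Measure ℝ} (hind : iIndepFun ξ P) (hmeas : ∀ k, AEMeasurable (ξ k) P)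
    (hmap : ∀ k, P.map (ξ k) = μ) (hμ : μ.map Neg.neg = μ) (n : ℕ) {y h : ℝ} (hy : 0 ≤ y)
    (hh : 0 ≤ h) (z : ℝ) :
    P.real {ω | z ≤ |(∑ k ∈ range n, cut y ∘ ξ k) ω|} ≤
      2 * (Real.exp (-h * z) *
        Real.exp (n * (h ^ 2 * Real.exp (h * y) * truncMoment μ y))) := by
  set S := ∑ k ∈ range n, cut y ∘ ξ k with hS
  have hSm : AEMeasurable S P :=
    Finset.aemeasurable_sum _ fun k _ => (measurable_cut y).comp_aemeasurable (hmeas k)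
  have hSb : ∀ ω, S ω ∈ Set.Icc (-(n * y)) (n * y) := by
    intro ω
    rw [Set.mem_Icc, ← abs_le, hS, Finset.sum_apply]
    refine (Finset.abs_sum_le_sum_abs _ _).trans ?_
    refine (Finset.sum_le_sum fun k _ => abs_cut_le hy (ξ k ω)).trans ?_
    simp
  have hint : ∀ t, Integrable (fun ω => Real.exp (t * S ω)) P := fun t =>
    integrable_exp_mul_of_mem_Icc hSm (ae_of_all _ hSb)
  have h1 := measure_ge_le_exp_mul_mgf z hh (hint h)
  have h2 := measure_le_le_exp_mul_mgf (-z) (neg_nonpos.2 hh) (hint (-h))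
  have h3 := mgf_sum_cut_le hind hmeas hmap hμ n hy h
  have h4 := mgf_sum_cut_le hind hmeas hmap hμ n hy (-h)
  rw [abs_of_nonneg hh] at h3
  rw [abs_neg, abs_of_nonneg hh, neg_sq] at h4
  rw [show - -h * -z = -h * z by ring] at h2
  have hsub : {ω | z ≤ |S ω|} ⊆ {ω | z ≤ S ω} ∪ {ω | S ω ≤ -z} := by
    intro ω (hω : z ≤ |S ω|)
    rcases le_abs.1 hω with h | h
    · exact Or.inl h
    · exact Or.inr (show S ω ≤ -z by linarith)
  have h5 := (measureReal_mono (μ := P) hsub).trans (measureReal_union_le _ _)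
  have h6 := mul_le_mul_of_nonneg_left h3 (Real.exp_pos (-h * z)).le
  have h7 := mul_le_mul_of_nonneg_left h4 (Real.exp_pos (-h * z)).le
  linarith

/-- Either some summand reaches `y`, or the sum equals the truncated one, to which Chernoff applies.
The factor `6` is what produces the cube of `r`, hence an error smaller than `x⁻²`. -/
theorem measureReal_abs_sum_le {P : Measure Ω} [IsProbabilityMeasure P] {ξ : ℕ → Ω → ℝ}
    {μ : Measure ℝ} (hind : iIndepFun ξ P) (hmeas : ∀ k, AEMeasurable (ξ k) P)
    (hmap : ∀ k, P.map (ξ k) = μ) (hμ : μ.map Neg.neg = μ) (n : ℕ) {y r : ℝ} (hy : 0 < y)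
    (hr : 0 < r) (hV : n * truncMoment μ y ≤ r * y ^ 2) :
    P.real {ω | 6 * y ≤ |∑ k ∈ range n, ξ k ω|} ≤
      n * μ.real {x | y ≤ |x|} + 2 * Real.exp 2 * r ^ 3 := by
  have hT0 : 0 ≤ n * μ.real {x : ℝ | y ≤ |x|} := by positivity
  by_cases hr1 : 1 ≤ r
  · have h1 : P.real {ω | 6 * y ≤ |∑ k ∈ range n, ξ k ω|} ≤ 1 := measureReal_le_one
    have h2 : 1 ≤ r ^ 3 := one_le_pow₀ hr1
    have h3 := Real.add_one_le_exp 2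
    nlinarith
  push Not at hr1
  -- The Chernoff parameter is `h = w / y` with `e^(-2w) = r`: then `e^(-6hy) = r³`, while the
  -- exponent is at most `w² e^w r ≤ 2 e^(2w) r = 2`.
  set w := -Real.log r / 2 with hw
  have hw0 : 0 ≤ w := by have := Real.log_nonpos hr.le hr1.le; rw [hw]; linarith
  have hexp : Real.exp (-(2 * w)) = r := by rw [hw, ← Real.exp_log hr]; congr 1; simp; ring
  have hsub : {ω | 6 * y ≤ |∑ k ∈ range n, ξ k ω|} ⊆
      (⋃ k ∈ range n, {ω | y ≤ |ξ k ω|}) ∪ {ω | 6 * y ≤ |(∑ k ∈ range n, cut y ∘ ξ k) ω|} := by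
    intro ω (hω : 6 * y ≤ |∑ k ∈ range n, ξ k ω|)
    by_cases hbig : ∃ k ∈ range n, y ≤ |ξ k ω|
    · obtain ⟨k, hk, hky⟩ := hbig
      exact Or.inl (Set.mem_biUnion hk hky)
    · push Not at hbig
      refine Or.inr ?_
      show 6 * y ≤ |(∑ k ∈ range n, cut y ∘ ξ k) ω|
      rw [Finset.sum_apply]
      have : ∑ k ∈ range n, (cut y ∘ ξ k) ω = ∑ k ∈ range n, ξ k ω :=
        Finset.sum_congr rfl fun k hk => by simp [cut, hbig k hk]
      rwa [this]
  have h1 := (measureReal_mono (μ := P) hsub).trans (measureReal_union_le _ _)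
  have h2 : P.real (⋃ k ∈ range n, {ω | y ≤ |ξ k ω|}) ≤ n * μ.real {x | y ≤ |x|} := by
    refine (measureReal_biUnion_finset_le _ _).trans_eq ?_
    rw [Finset.sum_congr rfl fun k _ => show P.real {ω | y ≤ |ξ k ω|} = μ.real {x | y ≤ |x|} by
      rw [← hmap k, map_measureReal_apply_of_aemeasurable (hmeas k) (measurableSet_le_abs y)]; rfl]
    simp
  have h3 := measureReal_abs_sum_cut_le hind hmeas hmap hμ n hy.le
    (div_nonneg hw0 hy.le) (6 * y)
  have h4 : n * ((w / y) ^ 2 * Real.exp (w / y * y) * truncMoment μ y) ≤ 2 := by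
    have e1 : w / y * y = w := div_mul_cancel₀ _ hy.ne'
    have e2 := Real.quadratic_le_exp_of_nonneg hw0
    rw [e1]
    calc n * ((w / y) ^ 2 * Real.exp w * truncMoment μ y)
        = (w / y) ^ 2 * Real.exp w * (n * truncMoment μ y) := by ring
      _ ≤ (w / y) ^ 2 * Real.exp w * (r * y ^ 2) := by gcongr
      _ = w ^ 2 * Real.exp w * r := by field_simp
      _ ≤ (2 * Real.exp w) * Real.exp w * r := by gcongr; linarith
      _ = 2 * (Real.exp w * Real.exp w * Real.exp (-(2 * w))) := by rw [hexp]; ring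
      _ = 2 := by rw [← Real.exp_add, ← Real.exp_add]; ring_nf; simp
  have h5 : Real.exp (-(w / y) * (6 * y)) = r ^ 3 := by
    rw [← hexp, ← Real.exp_nat_mul]; congr 1; field_simp; push_cast; ring
  rw [h5] at h3
  have h6 : r ^ 3 * Real.exp (n * ((w / y) ^ 2 * Real.exp (w / y * y) * truncMoment μ y)) ≤
      r ^ 3 * Real.exp 2 := by gcongr
  linarith

/-! ### Characteristic function and norming constants -/

theorem integrable_one_sub_cos (μ : Measure ℝ) [IsFiniteMeasure μ] (t : ℝ) :
    Integrable (fun x => 1 - Real.cos (t * x)) μ := by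
  refine Integrable.of_bound (by fun_prop) 2 (ae_of_all _ fun x => ?_)
  rw [Real.norm_eq_abs, abs_le]
  constructor <;> linarith [Real.neg_one_le_cos (t * x), Real.cos_le_one (t * x)]

theorem re_charFun_eq (μ : Measure ℝ) [IsFiniteMeasure μ] (t : ℝ) :
    (charFun μ t).re = ∫ x, Real.cos (t * x) ∂μ := by
  rw [charFun_apply_real]
  have hint : Integrable (fun x : ℝ => Complex.exp (t * x * Complex.I)) μ := by
    refine Integrable.of_bound (by fun_prop) 1 (ae_of_all _ fun x => ?_)
    rw [← Complex.ofReal_mul, Complex.norm_exp_ofReal_mul_I]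
  have h := integral_re hint
  simp only [RCLike.re_to_complex] at h
  rw [← h]
  refine integral_congr_ae (ae_of_all _ fun x => ?_)
  show (Complex.exp (t * x * Complex.I)).re = Real.cos (t * x)
  rw [← Complex.ofReal_mul, Complex.exp_ofReal_mul_I_re]

theorem psi_eq_integral {Ω : Type*} [MeasurableSpace Ω] {P : Measure Ω} [IsProbabilityMeasure P]
    {X : Ω → ℝ} (hX : AEMeasurable X P) (t : ℝ) :
    psi P X t = ∫ x, (1 - Real.cos (t * x)) ∂(P.map X) := by
  have := Measure.isProbabilityMeasure_map hX
  have hcos : Integrable (fun x => Real.cos (t * x)) (P.map X) := by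
    refine ((integrable_const (1 : ℝ)).sub (integrable_one_sub_cos (P.map X) t)).congr
      (ae_of_all _ fun x => ?_)
    simp
  rw [psi, re_charFun_eq, integral_sub (integrable_const 1) hcos]
  simp

/-- On `|u| ≤ 1` one has `1 - cos u ≥ 2u²/π² ≥ u²/5`. At a norming constant the integral is `1 / n`,
so this is the source of `n V(b) ≤ 5 b²`. -/
theorem truncMoment_le_integral_one_sub_cos (μ : Measure ℝ) [IsFiniteMeasure μ] {b : ℝ}
    (hb : 0 < b) : truncMoment μ b ≤ 5 * b ^ 2 * ∫ x, (1 - Real.cos (1 / b * x)) ∂μ := by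
  rw [← integral_const_mul]
  refine integral_mono (integrable_cut_sq μ b) ((integrable_one_sub_cos μ _).const_mul _)
    fun x => ?_
  have hnn : 0 ≤ 1 - Real.cos (1 / b * x) := by linarith [Real.cos_le_one (1 / b * x)]
  simp only [cut]
  split_ifs with h
  · have hu : |1 / b * x| ≤ Real.pi := by
      rw [abs_mul, abs_of_pos (by positivity : 0 < 1 / b), one_div_mul_eq_div]
      have : |x| / b ≤ 1 := (div_le_one hb).2 h.le
      linarith [Real.pi_gt_three]
    have h1 := Real.cos_le_one_sub_mul_cos_sq hu
    have hpi : (1 : ℝ) / 5 ≤ 2 / Real.pi ^ 2 := by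
      rw [div_le_div_iff₀ (by norm_num) (by positivity)]
      nlinarith [Real.pi_lt_d2, Real.pi_pos]
    have h2 : 1 / 5 * (1 / b * x) ^ 2 ≤ 1 - Real.cos (1 / b * x) := by
      have := mul_le_mul_of_nonneg_right hpi (sq_nonneg (1 / b * x))
      linarith
    calc x ^ 2 = 5 * b ^ 2 * (1 / 5 * (1 / b * x) ^ 2) := by field_simp
      _ ≤ _ := by gcongr
  · have : 0 ≤ 5 * b ^ 2 * (1 - Real.cos (1 / b * x)) := by positivity
    simpa using this

/-- The part above `3` of the law of the absolute value. -/
noncomputable def absAbove (μ : Measure ℝ) : Measure ℝ :=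
  (μ.map fun x => |x|).restrict (Set.Ici 3)

instance isFiniteMeasure_absAbove (μ : Measure ℝ) [IsFiniteMeasure μ] :
    IsFiniteMeasure (absAbove μ) := by
  unfold absAbove; infer_instance

theorem absAbove_Ici (μ : Measure ℝ) (a : ℝ) :
    absAbove μ (Set.Ici a) = μ {x | max a 3 ≤ |x|} := by
  rw [absAbove, Measure.restrict_apply measurableSet_Ici, Set.Ici_inter_Ici,
    Measure.map_apply (by fun_prop) measurableSet_Ici]
  rfl

theorem absAbove_congr {μ μ' : Measure ℝ} [IsFiniteMeasure μ] [IsFiniteMeasure μ']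
    (h : ∀ y, 3 ≤ y → μ.real {x | y ≤ |x|} = μ'.real {x | y ≤ |x|}) :
    absAbove μ = absAbove μ' := by
  refine Measure.ext_of_Ici _ _ fun a => ?_
  rw [absAbove_Ici, absAbove_Ici, ← measureReal_eq_measureReal_iff]
  exact h _ (le_max_right _ _)

theorem integral_absAbove_le (μ : Measure ℝ) [IsFiniteMeasure μ] (t : ℝ) :
    ∫ y, (1 - Real.cos (t * y)) ∂(absAbove μ) ≤ ∫ x, (1 - Real.cos (t * x)) ∂μ := by
  have h1 : ∫ x, (1 - Real.cos (t * x)) ∂μ =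
      ∫ y, (1 - Real.cos (t * y)) ∂(μ.map fun x => |x|) := by
    rw [integral_map (by fun_prop) (by fun_prop)]
    refine integral_congr_ae (ae_of_all _ fun x => ?_)
    show 1 - Real.cos (t * x) = 1 - Real.cos (t * |x|)
    rcases abs_choice x with h | h <;> rw [h]
    rw [mul_neg, Real.cos_neg]
  rw [h1]
  exact setIntegral_le_integral (integrable_one_sub_cos _ t)
    (ae_of_all _ fun x => sub_nonneg.2 (Real.cos_le_one _))

/-- An atom at `a ≥ 3 > e` would be a jump of the tail function, which is continuous there. -/
theorem nonatomic_absAbove {μ : Measure ℝ} [IsFiniteMeasure μ]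
    (hc : ContinuousOn (fun y => μ.real {x | y ≤ |x|}) (Set.Ioi (Real.exp 1))) (a : ℝ) :
    absAbove μ {a} = 0 := by
  by_cases ha : a < 3
  · rw [absAbove, Measure.restrict_apply (measurableSet_singleton a)]
    have : ({a} : Set ℝ) ∩ Set.Ici 3 = ∅ := by
      rw [Set.singleton_inter_eq_empty]; simpa using ha
    simp [this]
  push Not at ha
  have hea : Real.exp 1 < a := by linarith [Real.exp_one_lt_d9]
  have hcont : ContinuousAt (fun y => μ.real {x | y ≤ |x|}) a :=
    hc.continuousAt (Ioi_mem_nhds hea)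
  have hlim : Tendsto (fun y => μ.real {x | a ≤ |x|} - μ.real {x | y ≤ |x|}) (𝓝[>] a) (𝓝 0) := by
    have := (tendsto_const_nhds (x := μ.real {x | a ≤ |x|})).sub
      (hcont.tendsto.mono_left nhdsWithin_le_nhds : Tendsto _ (𝓝[>] a) _)
    simpa using this
  have hle : ∀ᶠ y in 𝓝[>] a,
      (absAbove μ).real {a} ≤ μ.real {x | a ≤ |x|} - μ.real {x | y ≤ |x|} := by
    filter_upwards [self_mem_nhdsWithin] with y hy
    have hay : a < y := hy
    have hsub : {x : ℝ | y ≤ |x|} ⊆ {x | a ≤ |x|} := fun x hx => hay.le.trans hx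
    rw [← measureReal_sdiff hsub (measurableSet_le_abs y)]
    rw [absAbove, measureReal_restrict_apply (measurableSet_singleton a)]
    refine (measureReal_mono Set.inter_subset_left).trans ?_
    rw [map_measureReal_apply (by fun_prop) (measurableSet_singleton a)]
    refine measureReal_mono fun x hx => ?_
    have hx' : |x| = a := hx
    refine ⟨hx'.ge, fun h : y ≤ |x| => ?_⟩
    linarith
  have h0 := ge_of_tendsto hlim hle
  have h1 : (absAbove μ).real {a} = 0 := le_antisymm h0 measureReal_nonneg
  exact (measureReal_eq_zero_iff).1 h1

/-- The integrand vanishes only on a countable set, which is null for a measure without atoms; a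
lattice law could make the integral zero. -/
theorem integral_absAbove_pos {μ : Measure ℝ} [IsFiniteMeasure μ]
    (hc : ContinuousOn (fun y => μ.real {x | y ≤ |x|}) (Set.Ioi (Real.exp 1)))
    (h3 : 0 < μ.real {x | 3 ≤ |x|}) {t : ℝ} (ht : 0 < t) :
    0 < ∫ y, (1 - Real.cos (t * y)) ∂(absAbove μ) := by
  have hnn : 0 ≤ fun y => 1 - Real.cos (t * y) := fun y => sub_nonneg.2 (Real.cos_le_one _)
  refine lt_of_le_of_ne (integral_nonneg hnn) fun h => ?_
  have hz := (integral_eq_zero_iff_of_nonneg hnn (integrable_one_sub_cos _ t)).1 h.symm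
  have hcount : {y : ℝ | Real.cos (t * y) = 1}.Countable := by
    refine (Set.countable_range fun k : ℤ => k * (2 * Real.pi) / t).mono fun y hy => ?_
    obtain ⟨k, hk⟩ := (Real.cos_eq_one_iff _).1 hy
    exact ⟨k, by rw [div_eq_iff ht.ne', hk]; ring⟩
  have hnull : absAbove μ {y : ℝ | Real.cos (t * y) = 1} = 0 := by
    have : NullSingletonClass (absAbove μ) := ⟨nonatomic_absAbove hc⟩
    exact hcount.measure_zero _
  have hbot : absAbove μ Set.univ = 0 := by
    have h1 : ∀ᵐ y ∂(absAbove μ), False := by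
      have h2 : ∀ᵐ y ∂(absAbove μ), ¬ Real.cos (t * y) = 1 := by
        rw [ae_iff]; simpa using hnull
      filter_upwards [hz, h2] with y hy1 hy2
      exact hy2 (sub_eq_zero.1 hy1).symm
    simpa [ae_iff] using h1
  have h4 : μ {x | 3 ≤ |x|} = 0 := by
    have := absAbove_Ici μ 3
    rw [max_self] at this
    rw [← this]
    exact measure_mono_null (Set.subset_univ _) hbot
  rw [measureReal_def, h4] at h3
  simp at h3

theorem continuous_integral_one_sub_cos (ν : Measure ℝ) [IsFiniteMeasure ν] :
    Continuous fun t => ∫ y, (1 - Real.cos (t * y)) ∂ν := by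
  refine continuous_of_dominated (bound := fun _ => 2) (fun t => by fun_prop)
    (fun t => ae_of_all _ fun x => ?_) (integrable_const 2) (ae_of_all _ fun x => by fun_prop)
  rw [Real.norm_eq_abs, abs_le]
  constructor <;> linarith [Real.neg_one_le_cos (t * x), Real.cos_le_one (t * x)]

/-- All laws with tail `g` beyond `e` share the same `absAbove`, so the minimum of one continuous
positive function over a compact interval serves them all. -/
theorem exists_le_integral_one_sub_cos {g : ℝ → ℝ} (hg : ContinuousOn g (Set.Ioi (Real.exp 1)))
    (hpos : ∀ x, Real.exp 1 < x → 0 < g x) {β Y : ℝ} (hβ : 0 < β) :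
    ∃ c : ℝ, 0 < c ∧ ∀ μ : Measure ℝ, IsProbabilityMeasure μ →
      (∀ y, Real.exp 1 < y → μ.real {x | y ≤ |x|} = g y) →
      ∀ b, β ≤ b → b ≤ Y → c ≤ ∫ x, (1 - Real.cos (1 / b * x)) ∂μ := by
  -- A reference law is needed to define the minimum; if none exists the claim is vacuous.
  by_cases hex : ∃ μ : Measure ℝ, IsProbabilityMeasure μ ∧
      ∀ y, Real.exp 1 < y → μ.real {x | y ≤ |x|} = g y
  swap
  · exact ⟨1, one_pos, fun μ h1 h2 => (hex ⟨μ, h1, h2⟩).elim⟩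
  by_cases hβY : Y < β
  · exact ⟨1, one_pos, fun μ _ _ b hb1 hb2 => by linarith⟩
  push Not at hβY
  obtain ⟨μ₀, hμ₀, hg₀⟩ := hex
  have h3e : Real.exp 1 < 3 := by linarith [Real.exp_one_lt_d9]
  have hc : ContinuousOn (fun y => μ₀.real {x | y ≤ |x|}) (Set.Ioi (Real.exp 1)) :=
    hg.congr fun y hy => hg₀ y hy
  have h3 : 0 < μ₀.real {x | 3 ≤ |x|} := by rw [hg₀ 3 h3e]; exact hpos 3 h3e
  have hY : 0 < Y := hβ.trans_le hβY
  obtain ⟨t₀, ht₀, hmin⟩ := (isCompact_Icc (a := 1 / Y) (b := 1 / β)).exists_isMinOn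
    ⟨1 / Y, le_rfl, one_div_le_one_div_of_le hβ hβY⟩
    (continuous_integral_one_sub_cos (absAbove μ₀)).continuousOn
  refine ⟨_, integral_absAbove_pos hc h3 ((one_div_pos.2 hY).trans_le ht₀.1),
    fun μ hμ hgμ b hb1 hb2 => ?_⟩
  have hb : 0 < b := hβ.trans_le hb1
  have hcongr : absAbove μ = absAbove μ₀ := absAbove_congr fun y hy => by
    rw [hgμ y (by linarith), hg₀ y (by linarith)]
  refine le_trans ?_ (integral_absAbove_le μ (1 / b))
  rw [hcongr]
  exact hmin ⟨one_div_le_one_div_of_le hb hb2, one_div_le_one_div_of_le hβ hb1⟩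

/-- For `b n ≤ e^(s₁)` the lower bound on `ψ` forces `n ≤ 1 / c`. The extra `1` in `1 + 1 / c`
covers `n = 1`, where `b 1 = 1` need not solve any equation. -/
theorem IsNaturalNorming.normingBound {Ω : Type*} [MeasurableSpace Ω] {P : Measure Ω}
    [IsProbabilityMeasure P] {X : Ω → ℝ} {b : ℕ → ℝ} (hb : IsNaturalNorming P X b)
    (hX : AEMeasurable X P) {β c s₁ : ℝ} (hβ : 0 < β) (hc : 0 < c) (hs₁ : 0 ≤ s₁)
    (hcos : ∀ b, β ≤ b → b ≤ Real.exp s₁ →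
      c ≤ ∫ x, (1 - Real.cos (1 / b * x)) ∂(P.map X))
    {n : ℕ} (hn : n ∈ normable P X) (hβn : β ≤ b n) :
    NormingBound (truncMoment (P.map X)) β (1 + 1 / c) s₁ n (b n) := by
  have := Measure.isProbabilityMeasure_map hX
  have hc' : 0 < 1 / c := by positivity
  refine ⟨hβn, ?_⟩
  rcases hn with rfl | ⟨h2, hsol⟩
  · left
    rw [hb.one]
    refine ⟨Real.one_le_exp hs₁, ?_⟩
    push_cast; linarith
  · have hpsi := hb.psi_eq n (Or.inr ⟨h2, hsol⟩) h2
    rw [psi_eq_integral hX] at hpsi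
    have hn0 : (0 : ℝ) < n := by exact_mod_cast (by omega : 0 < n)
    rcases le_total (b n) (Real.exp s₁) with h | h
    · left
      have h1 := hcos (b n) hβn h
      rw [hpsi] at h1
      refine ⟨h, ?_⟩
      have : (n : ℝ) ≤ 1 / c := (le_one_div hc hn0).1 h1
      linarith
    · right
      have h1 := truncMoment_le_integral_one_sub_cos (P.map X) (hβ.trans_le hβn)
      rw [hpsi, mul_one_div, le_div_iff₀ hn0] at h1
      exact ⟨h, by linarith⟩

/-! ### Uniform constants and the two cases -/

/-- The standing assumptions on the summands `ξ` and the norming sequence `b`. -/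
structure NormedWalk {Ω : Type*} [MeasurableSpace Ω] (P : Measure Ω) (ξ : ℕ → Ω → ℝ)
    (b : ℕ → ℝ) (γ : ℝ) (L : ℝ → ℝ) (β : ℝ) : Prop where
  indep : iIndepFun ξ P
  ident : ∀ k, IdentDistrib (ξ k) (ξ 0) P P
  symm : IsSymmetric P (ξ 0)
  regular : HasRegularTail P (ξ 0) 2 γ L
  norming : IsNaturalNorming P (ξ 0) b
  le_norming : ∀ n ∈ normable P (ξ 0), β ≤ b n

theorem rpow_neg_two (x : ℝ) : x ^ (-2 : ℝ) = (x ^ 2)⁻¹ := by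
  rw [show (-2 : ℝ) = ((-2 : ℤ) : ℝ) by norm_num, Real.rpow_intCast]; rfl

theorem tail_eq_map {Ω : Type*} [MeasurableSpace Ω] {P : Measure Ω} {X : Ω → ℝ}
    (hX : AEMeasurable X P) (y : ℝ) : tail P X y = (P.map X).real {x | y ≤ |x|} := by
  rw [map_measureReal_apply_of_aemeasurable hX (measurableSet_le_abs y)]; rfl

/-- Uniformly over all admissible walks, the law of the summands satisfies the growth bounds, and
the tails of the normed sums are dominated by the probability of one big summand up to an error
of cubic decay. -/
theorem exists_uniform_constants (γ : ℝ) {L : ℝ → ℝ} (hL : IsSlowlyVarying L) {β : ℝ}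
    (hβ : 0 < β) :
    ∃ C s₀ c D s₁ N R : ℝ, 1 ≤ C ∧ 1 < s₀ ∧ DoublingComparable (fun u => u ^ γ * L u) C s₀ ∧
      0 < c ∧ 2 ≤ s₁ ∧ s₀ ≤ s₁ ∧ 0 ≤ N ∧ 0 < R ∧
      ∀ (Ω : Type*) [MeasurableSpace Ω] (P : Measure Ω) [IsProbabilityMeasure P]
        (ξ : ℕ → Ω → ℝ) (b : ℕ → ℝ), NormedWalk P ξ b γ L β →
        TailMoment (tail P (ξ 0)) (truncMoment (P.map (ξ 0))) ∧
        GrowthBound (fun u => u ^ γ * L u) (truncMoment (P.map (ξ 0))) c D s₁ ∧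
        (∀ u, 1 < u → tail P (ξ 0) (Real.exp u) * Real.exp u ^ 2 = u ^ γ * L u) ∧
        ∀ n ∈ normable P (ξ 0), NormingBound (truncMoment (P.map (ξ 0))) β N s₁ n (b n) ∧
          ∀ x, 1 ≤ x → tail P (normedSum ξ b n) x ≤
            n * tail P (ξ 0) (x * b n / 6) + R / x ^ 3 := by
  obtain ⟨C, s₀, hC, hs₀, hl⟩ := hL.exists_rpow_mul_ratio_bound γ
  have hlpos : ∀ z, 1 < z → 0 < z ^ γ * L z := fun z hz =>
    mul_pos (Real.rpow_pos_of_pos (by linarith) _) (hL.pos z hz)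
  obtain ⟨c, D, s₁, hc, hD, hs₁, hs₀₁, hgrowth⟩ :=
    TailMoment.exists_growth_constants hlpos hC hs₀ hl
  have hlog : ∀ x, Real.exp 1 < x → 1 < Real.log x := fun x hx =>
    (Real.lt_log_iff_exp_lt ((Real.exp_pos 1).trans hx)).2 hx
  have hg : ContinuousOn (fun x : ℝ => x ^ (-2 : ℝ) * Real.log x ^ γ * L (Real.log x))
      (Set.Ioi (Real.exp 1)) := by
    have hne : ∀ x ∈ Set.Ioi (Real.exp 1), x ≠ 0 := fun x hx => ((Real.exp_pos 1).trans hx).ne'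
    have hlc : ContinuousOn Real.log (Set.Ioi (Real.exp 1)) := continuousOn_id.log hne
    refine ((continuousOn_id.rpow_const fun x hx => Or.inl (hne x hx)).mul
      (hlc.rpow_const fun x hx => Or.inl ?_)).mul (hL.continuousOn.comp hlc hlog)
    exact (one_pos.trans (hlog x hx)).ne'
  have hgpos : ∀ x, Real.exp 1 < x → 0 < x ^ (-2 : ℝ) * Real.log x ^ γ * L (Real.log x) := by
    intro x hx
    rw [mul_assoc]
    exact mul_pos (Real.rpow_pos_of_pos ((Real.exp_pos 1).trans hx) _) (hlpos _ (hlog x hx))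
  obtain ⟨c₀, hc₀, hcos⟩ := exists_le_integral_one_sub_cos hg hgpos (Y := Real.exp s₁) hβ
  set N := 1 + 1 / c₀ with hN
  have hN0 : 0 ≤ N := by positivity
  set r := 36 * (N * (D * Real.exp s₁ ^ 2) / β ^ 2 + 5 * D) with hr
  have hr0 : 0 < r := by positivity
  refine ⟨C, s₀, c, D, s₁, N, 2 * Real.exp 2 * r ^ 3, hC, hs₀, hl, hc, hs₁, hs₀₁, hN0,
    by positivity, ?_⟩
  intro Ω _ P _ ξ b hW
  have hmeas : ∀ k, AEMeasurable (ξ k) P := fun k => (hW.ident k).aemeasurable_fst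
  have hmap : ∀ k, P.map (ξ k) = P.map (ξ 0) := fun k => (hW.ident k).map_eq
  have hprob := Measure.isProbabilityMeasure_map (hmeas 0)
  have hsymm : (P.map (ξ 0)).map Neg.neg = P.map (ξ 0) := by
    rw [AEMeasurable.map_map_of_aemeasurable measurable_neg.aemeasurable (hmeas 0)]
    exact hW.symm.map_eq.symm
  have htail : tail P (ξ 0) = fun y => (P.map (ξ 0)).real {x | y ≤ |x|} :=
    funext fun y => tail_eq_map (hmeas 0) y
  have hTV : TailMoment (tail P (ξ 0)) (truncMoment (P.map (ξ 0))) := by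
    rw [htail]; exact tailMoment_truncMoment _
  have hT : ∀ u, 1 < u → tail P (ξ 0) (Real.exp u) * Real.exp u ^ 2 = u ^ γ * L u := by
    intro u hu
    rw [hW.regular _ (Real.exp_lt_exp.2 hu), Real.log_exp, rpow_neg_two]
    field_simp
  have hG : GrowthBound (fun u => u ^ γ * L u) (truncMoment (P.map (ξ 0))) c D s₁ :=
    ⟨fun s hs => (hgrowth _ _ hTV hT s hs).1, fun s hs => (hgrowth _ _ hTV hT s hs).2.1,
      fun s hs => (hgrowth _ _ hTV hT s hs).2.2⟩
  refine ⟨hTV, hG, hT, fun n hn => ?_⟩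
  have hβn := hW.le_norming n hn
  have hb0 : 0 < b n := hβ.trans_le hβn
  have hnorm := hW.norming.normingBound (hmeas 0) hβ hc₀ (by linarith : 0 ≤ s₁)
    (hcos _ hprob fun y hy => by rw [← tail_eq_map (hmeas 0), hW.regular y hy]) hn hβn
  refine ⟨hnorm, fun x hx => ?_⟩
  have hx0 : 0 < x := one_pos.trans_le hx
  have hV := hnorm.mul_moment_le hβ hN0 hD hTV hG hx
  have key := measureReal_abs_sum_le hW.indep hmeas hmap hsymm n (y := x * b n / 6)
    (by positivity) (div_pos hr0 hx0) hV
  have hset : tail P (normedSum ξ b n) x =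
      P.real {ω | 6 * (x * b n / 6) ≤ |∑ k ∈ range n, ξ k ω|} := by
    rw [tail]
    congr 1
    ext ω
    show x ≤ |normedSum ξ b n ω| ↔ 6 * (x * b n / 6) ≤ |∑ k ∈ range n, ξ k ω|
    rw [normedSum, abs_mul, abs_inv, abs_of_pos hb0, inv_mul_eq_div, le_div_iff₀ hb0,
      mul_div_cancel₀ _ (by norm_num : (6 : ℝ) ≠ 0)]
  rw [hset, tail_eq_map (hmeas 0)]
  refine key.trans_eq ?_
  ring

theorem uniformTail_le {Ω : Type*} [MeasurableSpace Ω] {P : Measure Ω} {ξ : ℕ → Ω → ℝ}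
    {b : ℕ → ℝ} {x B : ℝ} (h : ∀ n ∈ normable P (ξ 0), tail P (normedSum ξ b n) x ≤ B) :
    uniformTail P ξ b x ≤ B := by
  have : Nonempty (normable P (ξ 0)) := ⟨⟨1, Or.inl rfl⟩⟩
  exact ciSup_le fun n => h n n.2

theorem exists_uniformTail_le_of_ge {γ : ℝ} (hγ : -1 ≤ γ) {L : ℝ → ℝ} (hL : IsSlowlyVarying L)
    {β : ℝ} (hβ : 0 < β) :
    ∃ K : ℝ, 0 < K ∧
      ∀ (Ω : Type*) [MeasurableSpace Ω] (P : Measure Ω) [IsProbabilityMeasure P]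
        (ξ : ℕ → Ω → ℝ) (b : ℕ → ℝ), NormedWalk P ξ b γ L β → ∀ x, Real.exp 1 < x →
        uniformTail P ξ b x ≤ K * (tail P (ξ 0) x * Real.log x) := by
  obtain ⟨C, s₀, c, D, s₁, N, R, hC, hs₀, hl, hc, hs₁, hs₀₁, hN, hR, hunif⟩ :=
    exists_uniform_constants γ hL hβ
  obtain ⟨κ, z₀, hκ, hz₀, hlt⟩ := hL.exists_le_sq_mul hγ
  have hlpos : ∀ z, 1 < z → 0 < z ^ γ * L z := fun z hz =>
    mul_pos (Real.rpow_pos_of_pos (by linarith) _) (hL.pos z hz)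
  set d := |Real.log (β / 6)| with hd
  have hd0 : 0 ≤ d := abs_nonneg _
  have hdβ : Real.exp (-d) ≤ β / 6 := by
    rw [← Real.le_log_iff_exp_le (by positivity)]; exact neg_abs_le _
  set t₀ := max (s₀ + 2 * d + 2) z₀ with ht₀
  have ht₀1 : 1 < t₀ := hz₀.trans_le (le_max_right _ _)
  set E := N * C * Real.exp d ^ 2 + 180 * C / c + 180 * C / c / κ with hE
  have hE0 : 0 ≤ E := by positivity
  -- This is the reciprocal of the tail at `e^(t₀)`; it makes the bound at least `1`, hence trivial,
  -- for `e < x < e^(t₀)`.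
  set K₀ := Real.exp t₀ ^ 2 / (t₀ ^ γ * L t₀) with hK₀
  have hK₀0 : 0 < K₀ := div_pos (by positivity) (hlpos _ ht₀1)
  refine ⟨E + R / κ + K₀, by positivity, fun Ω _ P _ ξ b hW x hx => uniformTail_le fun n hn => ?_⟩
  obtain ⟨hTV, hG, hT, hnorm⟩ := hunif Ω P ξ b hW
  obtain ⟨hnb, htail⟩ := hnorm n hn
  have hx0 : 0 < x := (Real.exp_pos 1).trans hx
  have hx1 : 1 ≤ x := by linarith [Real.add_one_le_exp 1]
  set t := Real.log x with ht
  have ht1 : 1 < t := (Real.lt_log_iff_exp_lt hx0).2 hx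
  have hxt : Real.exp t = x := Real.exp_log hx0
  have hTx := hT t ht1
  rw [hxt] at hTx
  have hT0 : 0 ≤ tail P (ξ 0) x * t := mul_nonneg (hTV.tail_nonneg x) (by linarith)
  by_cases htt : t₀ ≤ t
  · have h1 := hnb.mul_tail_le_of_ge hlpos hC hs₀ hl hβ hN hc hs₁ hTV hG hT hκ hlt hd0 hdβ
      hx0 ((le_max_left _ _).trans htt) ((le_max_right _ _).trans htt)
    have h2 := htail x hx1
    -- The cubic error is absorbed through `1 / x ≤ 1 / t`.
    have h3 : 1 / x ≤ t * (t ^ γ * L t) / κ := by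
      have hlt' := hlt t ((le_max_right _ _).trans htt)
      have h4 : t ≤ x := by rw [← hxt]; linarith [Real.add_one_le_exp t]
      have h5 : 0 < t * (t ^ γ * L t) := mul_pos (by linarith) (hlpos t ht1)
      rw [div_le_div_iff₀ hx0 hκ]
      calc 1 * κ ≤ t * (t ^ γ * L t) * t := by linarith
        _ ≤ _ := by gcongr
    have h4 : R / x ^ 3 * x ^ 2 ≤ R / κ * (t * (t ^ γ * L t)) := by
      calc R / x ^ 3 * x ^ 2 = R * (1 / x) := by field_simp
        _ ≤ R * (t * (t ^ γ * L t) / κ) := by gcongr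
        _ = _ := by ring
    have h5 : tail P (normedSum ξ b n) x * x ^ 2 ≤
        (E + R / κ) * (tail P (ξ 0) x * t) * x ^ 2 := by
      calc tail P (normedSum ξ b n) x * x ^ 2
          ≤ (n * tail P (ξ 0) (x * b n / 6) + R / x ^ 3) * x ^ 2 := by gcongr
        _ ≤ (E + R / κ) * (t * (t ^ γ * L t)) := by linarith
        _ = _ := by rw [← hTx]; ring
    have h6 := le_of_mul_le_mul_right h5 (by positivity)
    have h7 := mul_nonneg hK₀0.le hT0
    linarith
  · push Not at htt
    have h1 : tail P (normedSum ξ b n) x ≤ 1 := measureReal_le_one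
    have h2 : tail P (ξ 0) (Real.exp t₀) ≤ tail P (ξ 0) x :=
      hTV.tail_anti (by rw [← hxt]; exact Real.exp_le_exp.2 htt.le)
    have h3 : K₀ * tail P (ξ 0) (Real.exp t₀) = 1 := by
      have h4 := hT t₀ ht₀1
      rw [hK₀, div_mul_eq_mul_div, div_eq_one_iff_eq (hlpos _ ht₀1).ne', mul_comm, h4]
    have h4 : tail P (ξ 0) x ≤ tail P (ξ 0) x * t :=
      le_mul_of_one_le_right (hTV.tail_nonneg x) ht1.le
    have h5 := mul_le_mul_of_nonneg_left (h2.trans h4) hK₀0.le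
    have h6 : 0 ≤ (E + R / κ) * (tail P (ξ 0) x * t) := by positivity
    linarith

theorem exists_uniformTail_le_of_lt {γ : ℝ} (hγ : γ < -1) {L : ℝ → ℝ} (hL : IsSlowlyVarying L)
    {β : ℝ} (hβ : 0 < β) :
    ∃ K : ℝ, 0 < K ∧
      ∀ (Ω : Type*) [MeasurableSpace Ω] (P : Measure Ω) [IsProbabilityMeasure P]
        (ξ : ℕ → Ω → ℝ) (b : ℕ → ℝ), NormedWalk P ξ b γ L β → ∀ x, 1 < x →
        uniformTail P ξ b x ≤ K * x ^ (-2 : ℝ) := by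
  obtain ⟨C, s₀, c, D, s₁, N, R, hC, hs₀, hl, hc, hs₁, hs₀₁, hN, hR, hunif⟩ :=
    exists_uniform_constants γ hL hβ
  obtain ⟨A, z₀, hA, hz₀, hlA⟩ := hL.exists_rpow_mul_le hγ
  refine ⟨36 * (N / β ^ 2 + 5 / c) * (Real.exp z₀ ^ 2 + A) + R, by positivity,
    fun Ω _ P _ ξ b hW x hx => uniformTail_le fun n hn => ?_⟩
  obtain ⟨hTV, hG, hT, hnorm⟩ := hunif Ω P ξ b hW
  obtain ⟨hnb, htail⟩ := hnorm n hn
  have hx0 : 0 < x := one_pos.trans hx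
  have h1 := hnb.mul_tail_le_of_le hβ hN hc hTV hG hT hz₀ hA hlA hx.le
  have h2 := htail x hx.le
  have h3 : R / x ^ 3 * x ^ 2 ≤ R := by
    calc R / x ^ 3 * x ^ 2 = R / x := by field_simp
      _ ≤ R := div_le_self hR.le hx.le
  rw [rpow_neg_two, ← div_eq_mul_inv, le_div_iff₀ (by positivity)]
  calc tail P (normedSum ξ b n) x * x ^ 2
      ≤ (n * tail P (ξ 0) (x * b n / 6) + R / x ^ 3) * x ^ 2 := by gcongr
    _ ≤ _ := by linarith

end UniformTail

open UniformTail in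
theorem theorem3p1 (γ : ℝ) (L : ℝ → ℝ) (hL : IsSlowlyVarying L) (β : ℝ) (hβ : 0 < β) :
    ∃ C : ℝ, 0 < C ∧
      ∀ (Ω : Type*) [MeasurableSpace Ω] (P : Measure Ω) [IsProbabilityMeasure P]
        (ξ : ℕ → Ω → ℝ) (b : ℕ → ℝ),
        iIndepFun ξ P →
        (∀ k, IdentDistrib (ξ k) (ξ 0) P P) →
        IsSymmetric P (ξ 0) →
        HasRegularTail P (ξ 0) 2 γ L →
        IsNaturalNorming P (ξ 0) b →
        (∀ n ∈ normable P (ξ 0), β ≤ b n) →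
        (-1 ≤ γ → ∀ x, Real.exp 1 < x →
          uniformTail P ξ b x ≤ C * (x ^ (-2 : ℝ) * Real.log x ^ (γ + 1) * L (Real.log x)) ∧
          x ^ (-2 : ℝ) * Real.log x ^ (γ + 1) * L (Real.log x) = tail P (ξ 0) x * Real.log x) ∧
        (γ < -1 → ∀ x, 1 < x → uniformTail P ξ b x ≤ C * x ^ (-2 : ℝ)) := by
  rcases le_or_gt (-1) γ with hγ | hγ
  · obtain ⟨K, hK, h⟩ := exists_uniformTail_le_of_ge hγ hL hβ
    refine ⟨K, hK, fun Ω _ P _ ξ b h1 h2 h3 h4 h5 h6 =>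
      ⟨fun _ x hx => ?_, fun hlt => absurd hγ (not_le.2 hlt)⟩⟩
    have hlog : 0 < Real.log x :=
      one_pos.trans ((Real.lt_log_iff_exp_lt ((Real.exp_pos 1).trans hx)).2 hx)
    have heq : x ^ (-2 : ℝ) * Real.log x ^ (γ + 1) * L (Real.log x) =
        tail P (ξ 0) x * Real.log x := by
      rw [h4 x hx, Real.rpow_add_one hlog.ne']; ring
    exact ⟨heq ▸ h Ω P ξ b ⟨h1, h2, h3, h4, h5, h6⟩ x hx, heq⟩
  · obtain ⟨K, hK, h⟩ := exists_uniformTail_le_of_lt hγ hL hβ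
    exact ⟨K, hK, fun Ω _ P _ ξ b h1 h2 h3 h4 h5 h6 =>
      ⟨fun hge => absurd hge (not_le.2 hγ),
        fun _ x hx => h Ω P ξ b ⟨h1, h2, h3, h4, h5, h6⟩ x hx⟩⟩
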